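/- **Theorem 1.3.** Let $\mathbb H=\{x+iy:y>0\}$ carry the hyperbolic metric, let $T^1\mathbb H$ be its unit tangent bundle, let $M=\mathrm{PSL}(2,\mathbb Z)\backslash\mathbb H$ and $T^1M=\mathrm{PSL}(2,\mathbb Z)\backslash T^1\mathbb H$, and let $g_t$ be the geodesic flow on $T^1M$. For $d>1$ let $\overline M_d\subset T^1M$ be the image of the set of unit tangent vectors with base point in $\{\operatorname{Im} z>d\}$, and let $\chi_{\overline M_d}$ be its characteristic function. The forward orbit $\{g_tv\}_{t\ge0}$ of $v\in T^1M$ *visits the cusp with frequency $0$* if $\frac1T\int_0^T\chi_{\overline M_d}(g_tv)\,dt\to0$ as $T\to\infty$ for some $d>1$, and *visits the cusp with frequency $1$* if $\frac1T\int_0^T\chi_{\overline M_d}(g_tv)\,dt\to1$ as $T\to\infty$ for every $d>1$. Let $-1\le a<0<b\le1$ with $b-a\ge1$. Put $[x]_{a,b}=\lfloor x-a\rfloor$ if $x<a$, $[x]_{a,b}=0$ if $a\le x<b$, and $[x]_{a,b}=\lfloor x-b\rfloor+1$ if $x\ge b$. The $(a,b)$-continued fraction expansion $x=[a_0,a_1,a_2,\dots]_{a,b}$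 of an irrational $x$ is given by $x_0=x$, $a_j=[x_j]_{a,b}$, $x_{j+1}=-1/(x_j-a_j)$. Let $f_{a,b}:\mathbb R\cup\{\infty\}\to\mathbb R\cup\{\infty\}$ be $y\mapsto y+1$ for $y<a$, $y\mapsto-1/y$ for $a\le y<b$ (with $0\mapsto\infty$), $y\mapsto y-1$ for $y\ge b$, and $\infty\mapsto\infty$. Let $\mathcal S$ be the set of such pairs $(a,b)$ that satisfy the finiteness condition: the $f_{a,b}$-orbits of $-1/a$ and $a+1$ are both eventually periodic or they meet (i.e. $f_{a,b}^{m}(-1/a)=f_{a,b}^{k}(a+1)$ for some $m,k\ge0$), and likewise for the orbits of $b-1$ and $-1/b$. Let $(a,b)\in\mathcal S$, let $v\in T^1M$, let $\gamma_v$ be the corresponding geodesic in $M$, and let $x$ be the attracting endpoint of a lift of $\gamma_v$ to $\mathbb H$; assume that $x$ is irrational, and let $x=[a_0,a_1,a_2,\dots]_{a,b}$. For $\xi>1$ put $a_j^\xi=a_j$ if $|a_j|>\xi$ and $a_j^\xi=1$ if $|a_j|\le\xi$. Then 1. $\{g_tv\}_{t\ge0}$ visits the cusp with frequency $0$ if and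 only if $\frac1N\sum_{j=0}^{N-1}\log|a_j^\xi|\to0$ as $N\to\infty$ for some $\xi>1$; 2. $\{g_tv\}_{t\ge0}$ visits the cusp with frequency $1$ if and only if $\frac1N\sum_{j=0}^{N-1}\log|a_j|\to\infty$ as $N\to\infty$, where a possible initial term with $a_0=0$ is counted as $0$. -/

import Mathlib

noncomputable section

open Filter Topology
open scoped UpperHalfPlane MatrixGroups ComplexConjugate

namespace CuspExcursion

/-! ### The unit tangent bundle of the hyperbolic plane and of the modular surface -/

/-- A point of the unit tangent bundle `T¹ℍ`: a base point `z` of the upper half plane and a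
tangent vector `ζ` at `z` (a complex number) of length one for the metric
`(dx² + dy²) / y²`, i.e. with `|ζ| = Im z`. -/
@[ext]
structure T1H where
  base : ℍ
  dir : ℂ
  norm_dir : ‖dir‖ = base.im

/-- The factor `c z + d` of a matrix `(a b; c d)` of `SL(2,ℤ)`. -/
def factor (g : SL(2, ℤ)) (z : ℂ) : ℂ := ((g 1 0 : ℤ) : ℂ) * z + ((g 1 1 : ℤ) : ℂ)

theorem factor_ne_zero (g : SL(2, ℤ)) (z : ℍ) : factor g z ≠ 0 := by
  have h := UpperHalfPlane.denom_ne_zero (g : GL (Fin 2) ℝ) z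
  rwa [ModularGroup.denom_apply] at h

theorem factor_mul (g h : SL(2, ℤ)) (z : ℍ) :
    factor (g * h) z = factor g ↑(h • z) * factor h z := by
  have hh := factor_ne_zero h z
  have key : ((h • z : ℍ) : ℂ) =
      (((h 0 0 : ℤ) : ℂ) * z + ((h 0 1 : ℤ) : ℂ)) / factor h z := by
    rw [UpperHalfPlane.coe_specialLinearGroup_apply]; simp [factor]
  rw [key, factor, factor]
  have e : ∀ p q n D : ℂ, D ≠ 0 → (p * (n / D) + q) * D = p * n + q * D := by
    intro p q n D hD
    field_simp
  rw [e _ _ _ _ hh, factor]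
  simp only [Matrix.SpecialLinearGroup.coe_mul, Matrix.mul_apply, Fin.sum_univ_two]
  push_cast
  ring

theorem coe_smul_eq (g : SL(2, ℤ)) (z : ℍ) : ((g • z : ℍ) : ℂ) =
    (((g 0 0 : ℤ) : ℂ) * z + ((g 0 1 : ℤ) : ℂ)) / factor g z := by
  rw [UpperHalfPlane.coe_specialLinearGroup_apply]; simp [factor]

theorem im_smul_eq (g : SL(2, ℤ)) (z : ℍ) :
    (g • z).im = z.im / ‖factor g z‖ ^ 2 := by
  rw [ModularGroup.im_smul_eq_div_normSq, Complex.normSq_eq_norm_sq, ModularGroup.denom_apply]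
  rfl

/-- `SL(2,ℤ)` acts on `T¹ℍ` by Möbius transformations and their derivatives
`(z, ζ) ↦ (g z, ζ / (c z + d)²)`; the action factors through `PSL(2,ℤ)`. -/
instance : MulAction SL(2, ℤ) T1H where
  smul g v := ⟨g • v.base, v.dir / factor g v.base ^ 2, by
    rw [norm_div, norm_pow, v.norm_dir, im_smul_eq]⟩
  one_smul v := by
    refine T1H.ext (one_smul _ _) ?_
    change v.dir / factor 1 v.base ^ 2 = v.dir
    simp [factor]
  mul_smul g h v := by
    refine T1H.ext (mul_smul _ _ _) ?_
    change v.dir / factor (g * h) v.base ^ 2 =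
      v.dir / factor h v.base ^ 2 / factor g ↑(h • v.base) ^ 2
    rw [factor_mul, div_div, ← mul_pow, mul_comm]

theorem smul_base (g : SL(2, ℤ)) (v : T1H) : (g • v).base = g • v.base := rfl

theorem smul_dir (g : SL(2, ℤ)) (v : T1H) : (g • v).dir = v.dir / factor g v.base ^ 2 := rfl

/-- The unit tangent bundle `T¹M` of the modular surface `M = PSL(2,ℤ) \ ℍ`, as the quotient of
`T¹ℍ` by `PSL(2,ℤ)` (equivalently, by `SL(2,ℤ)`). -/
def T1M : Type := MulAction.orbitRel.Quotient SL(2, ℤ) T1H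

/-- The projection `π : T¹ℍ → T¹M`. -/
def proj (v : T1H) : T1M := Quotient.mk (MulAction.orbitRel SL(2, ℤ) T1H) v

/-! ### The geodesic flow -/

/-- The point `tanh (t / 2) ω`, `ω = -i ζ / Im z`, of the open unit disc. The Möbius map
`w ↦ (z - z̄ w) / (1 - w)` is an isometry of the Poincaré disc onto `ℍ` sending `0` to `z` and
the radius in direction `ω` to the geodesic ray leaving `z` in direction `ζ`. -/
def discPoint (t : ℝ) (v : T1H) : ℂ :=
  (Real.tanh (t / 2) : ℂ) * (-Complex.I * v.dir / v.base.im)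

theorem norm_unit (v : T1H) : ‖-Complex.I * v.dir / (v.base.im : ℂ)‖ = 1 := by
  have h := v.base.im_pos
  rw [norm_div, norm_mul, v.norm_dir]
  simp [abs_of_pos h, h.ne']

theorem norm_discPoint (t : ℝ) (v : T1H) : ‖discPoint t v‖ = |Real.tanh (t / 2)| := by
  rw [discPoint, norm_mul, norm_unit, Complex.norm_real, mul_one, Real.norm_eq_abs]

theorem norm_discPoint_lt (t : ℝ) (v : T1H) : ‖discPoint t v‖ < 1 := by
  rw [norm_discPoint]; exact Real.abs_tanh_lt_one _

theorem one_sub_discPoint_ne (t : ℝ) (v : T1H) : 1 - discPoint t v ≠ 0 := by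
  intro h
  have h1 : discPoint t v = 1 := (sub_eq_zero.mp h).symm
  have h2 := norm_discPoint_lt t v
  rw [h1] at h2; simp at h2

theorem im_moebius (z : ℍ) (w : ℂ) :
    (((z : ℂ) - conj (z : ℂ) * w) / (1 - w)).im = z.im * (1 - ‖w‖ ^ 2) / ‖1 - w‖ ^ 2 := by
  rw [Complex.div_im, ← Complex.normSq_eq_norm_sq, ← Complex.normSq_eq_norm_sq]
  rw [div_sub_div_same]
  congr 1
  simp [Complex.normSq_apply]
  ring

/-- The geodesic flow `g_t` on `T¹ℍ`: `g_t (z, ζ)` is the position and the velocity at time `t`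
of the unit speed geodesic of `ℍ` which starts at `z` with velocity `ζ`. -/
def flowH (t : ℝ) (v : T1H) : T1H where
  base := ⟨((v.base : ℂ) - conj (v.base : ℂ) * discPoint t v) / (1 - discPoint t v), by
    rw [im_moebius]
    have h1 := norm_discPoint_lt t v
    have h2 : 0 < ‖1 - discPoint t v‖ := norm_pos_iff.mpr (one_sub_discPoint_ne t v)
    have h3 : 0 < 1 - ‖discPoint t v‖ ^ 2 := by nlinarith [norm_nonneg (discPoint t v)]
    have h4 := v.base.im_pos
    positivity⟩
  dir := (1 - (Real.tanh (t / 2) : ℂ) ^ 2) * v.dir / (1 - discPoint t v) ^ 2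
  norm_dir := by
    change _ = (((v.base : ℂ) - conj (v.base : ℂ) * discPoint t v) / (1 - discPoint t v)).im
    have h1 := Real.abs_tanh_lt_one (t / 2)
    have h3 : 0 < 1 - Real.tanh (t / 2) ^ 2 := by
      rw [← sq_abs]; nlinarith [abs_nonneg (Real.tanh (t / 2))]
    have h5 : ‖(1 - (Real.tanh (t / 2) : ℂ) ^ 2)‖ = 1 - Real.tanh (t / 2) ^ 2 := by
      rw [← Complex.ofReal_pow, ← Complex.ofReal_one, ← Complex.ofReal_sub, Complex.norm_real,
        Real.norm_of_nonneg h3.le]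
    rw [im_moebius, norm_discPoint, sq_abs, norm_div, norm_mul, norm_pow, v.norm_dir, h5]
    ring

theorem flowH_base (t : ℝ) (v : T1H) : ((flowH t v).base : ℂ) =
    ((v.base : ℂ) - conj (v.base : ℂ) * discPoint t v) / (1 - discPoint t v) := rfl

theorem flowH_dir (t : ℝ) (v : T1H) : (flowH t v).dir =
    (1 - (Real.tanh (t / 2) : ℂ) ^ 2) * v.dir / (1 - discPoint t v) ^ 2 := rfl

/-- The flow starts at the given unit tangent vector. -/
theorem flowH_zero (v : T1H) : flowH 0 v = v := by
  apply T1H.ext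
  · apply UpperHalfPlane.ext
    rw [flowH_base]; simp [discPoint]
  · rw [flowH_dir]; simp [discPoint]

/-- The base point of `g_t v` moves at unit speed along a geodesic line of `ℍ`. -/
theorem dist_flowH (s t : ℝ) (v : T1H) : dist (flowH s v).base (flowH t v).base = |s - t| := by
  have hs := one_sub_discPoint_ne s v
  have ht := one_sub_discPoint_ne t v
  have htc : 1 - conj (discPoint t v) ≠ 0 := by
    intro h0
    apply ht
    have := congrArg conj h0
    rwa [map_sub, map_one, Complex.conj_conj, map_zero] at this
  have hω := norm_unit v
  have hwt : discPoint s v - discPoint t v =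
      ((Real.tanh (s / 2) - Real.tanh (t / 2) : ℝ) : ℂ) *
        (-Complex.I * v.dir / (v.base.im : ℂ)) := by
    rw [discPoint, discPoint]; push_cast; ring
  have hww : discPoint s v * conj (discPoint t v) =
      ((Real.tanh (s / 2) * Real.tanh (t / 2) : ℝ) : ℂ) := by
    rw [discPoint, discPoint, map_mul, Complex.conj_ofReal, mul_mul_mul_comm, Complex.mul_conj,
      Complex.normSq_eq_norm_sq, hω]
    push_cast; ring
  have hz : ‖(v.base : ℂ) - conj (v.base : ℂ)‖ ≠ 0 := by
    rw [norm_ne_zero_iff, Complex.sub_conj]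
    simp [v.base.im_ne_zero]
  have h1 : ((flowH s v).base : ℂ) - (flowH t v).base =
      ((v.base : ℂ) - conj (v.base : ℂ)) * (discPoint s v - discPoint t v) /
        ((1 - discPoint s v) * (1 - discPoint t v)) := by
    rw [flowH_base, flowH_base]; field_simp; ring
  have h2 : ((flowH s v).base : ℂ) - conj ((flowH t v).base : ℂ) =
      ((v.base : ℂ) - conj (v.base : ℂ)) * (1 - discPoint s v * conj (discPoint t v)) /
        ((1 - discPoint s v) * (1 - conj (discPoint t v))) := by
    rw [flowH_base, flowH_base]
    simp only [map_div₀, map_sub, map_mul, map_one, Complex.conj_conj]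
    field_simp; ring
  have hconj : ‖1 - conj (discPoint t v)‖ = ‖1 - discPoint t v‖ := by
    rw [← Complex.norm_conj, map_sub, map_one, Complex.conj_conj]
  have hlt : 0 < 1 - Real.tanh (s / 2) * Real.tanh (t / 2) := by
    have a1 := Real.abs_tanh_lt_one (s / 2)
    have a2 := Real.abs_tanh_lt_one (t / 2)
    have a3 : |Real.tanh (s / 2) * Real.tanh (t / 2)| < 1 := by
      rw [abs_mul]
      nlinarith [abs_nonneg (Real.tanh (s / 2)), abs_nonneg (Real.tanh (t / 2))]
    linarith [(abs_lt.mp a3).2]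
  have h3 : Real.tanh (dist (flowH s v).base (flowH t v).base / 2) =
      |Real.tanh (s / 2) - Real.tanh (t / 2)| / (1 - Real.tanh (s / 2) * Real.tanh (t / 2)) := by
    rw [UpperHalfPlane.tanh_half_dist, Complex.dist_eq, Complex.dist_eq, h1, h2, hww, hwt]
    rw [norm_div, norm_div, norm_mul, norm_mul, norm_mul, norm_mul, norm_mul, hconj, hω,
      Complex.norm_real, ← Complex.ofReal_one, ← Complex.ofReal_sub, Complex.norm_real,
      Real.norm_eq_abs, Real.norm_eq_abs, abs_of_pos hlt, Complex.ofReal_one]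
    have n1 := norm_ne_zero_iff.mpr hs
    have n2 := norm_ne_zero_iff.mpr ht
    field_simp
  have hadd : Real.tanh ((s - t) / 2) =
      (Real.tanh (s / 2) - Real.tanh (t / 2)) / (1 - Real.tanh (s / 2) * Real.tanh (t / 2)) := by
    have c1 := (Real.cosh_pos (s / 2)).ne'
    have c2 := (Real.cosh_pos (t / 2)).ne'
    rw [eq_div_iff hlt.ne']
    rw [sub_div, Real.tanh_eq_sinh_div_cosh, Real.tanh_eq_sinh_div_cosh,
      Real.tanh_eq_sinh_div_cosh, Real.sinh_sub, Real.cosh_sub]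
    have c3 : Real.cosh (s / 2) * Real.cosh (t / 2) - Real.sinh (s / 2) * Real.sinh (t / 2) ≠ 0 := by
      rw [← Real.cosh_sub]; exact (Real.cosh_pos _).ne'
    rw [show Real.sinh (s / 2) / Real.cosh (s / 2) - Real.sinh (t / 2) / Real.cosh (t / 2) =
      (Real.sinh (s / 2) * Real.cosh (t / 2) - Real.cosh (s / 2) * Real.sinh (t / 2)) /
        (Real.cosh (s / 2) * Real.cosh (t / 2)) by field_simp,
      show 1 - Real.sinh (s / 2) / Real.cosh (s / 2) * (Real.sinh (t / 2) / Real.cosh (t / 2)) =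
      (Real.cosh (s / 2) * Real.cosh (t / 2) - Real.sinh (s / 2) * Real.sinh (t / 2)) /
        (Real.cosh (s / 2) * Real.cosh (t / 2)) by field_simp]
    rw [div_mul_div_comm, mul_comm (Real.cosh (s / 2) * Real.cosh (t / 2) - _),
      mul_div_mul_right _ _ c3]
  have h4 : Real.tanh (|s - t| / 2) =
      |Real.tanh (s / 2) - Real.tanh (t / 2)| / (1 - Real.tanh (s / 2) * Real.tanh (t / 2)) := by
    rw [← abs_of_pos hlt, ← abs_div, ← hadd]
    rcases le_total 0 (s - t) with h | h
    · rw [abs_of_nonneg h, abs_of_nonneg]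
      rw [Real.tanh_eq_sinh_div_cosh]
      exact div_nonneg (Real.sinh_nonneg_iff.mpr (by linarith)) (Real.cosh_pos _).le
    · rw [abs_of_nonpos h, abs_of_nonpos, neg_div, Real.tanh_neg]
      rw [Real.tanh_eq_sinh_div_cosh]
      exact div_nonpos_of_nonpos_of_nonneg (Real.sinh_nonpos_iff.mpr (by linarith))
        (Real.cosh_pos _).le
  have h5 := Real.tanh_injective (h3.trans h4.symm)
  linarith

/-- The vector of `g_t v` is the velocity of its base point. -/
theorem hasDerivAt_flowH (t : ℝ) (v : T1H) :
    HasDerivAt (fun s : ℝ => ((flowH s v).base : ℂ)) (flowH t v).dir t := by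
  have hi : (v.base.im : ℂ) ≠ 0 := Complex.ofReal_ne_zero.mpr v.base.im_ne_zero
  have hne := one_sub_discPoint_ne t v
  have hT : HasDerivAt (fun s : ℝ => Real.tanh (s / 2))
      ((1 - Real.tanh (t / 2) ^ 2) / 2) t := by
    have c := (Real.cosh_pos (t / 2)).ne'
    have hh : HasDerivAt (fun s : ℝ => s / 2) (1 / 2) t := (hasDerivAt_id t).div_const 2
    have := (hh.sinh).div (hh.cosh) c
    have e : (fun s : ℝ => Real.tanh (s / 2)) =
        (fun s : ℝ => Real.sinh (s / 2)) / fun s : ℝ => Real.cosh (s / 2) := by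
      funext s; simp [Real.tanh_eq_sinh_div_cosh]
    rw [e]
    refine this.congr_deriv ?_
    rw [Real.tanh_eq_sinh_div_cosh]
    field_simp
  have hw : HasDerivAt (fun s : ℝ => discPoint s v)
      (((1 - Real.tanh (t / 2) ^ 2) / 2 : ℝ) * (-Complex.I * v.dir / v.base.im)) t :=
    hT.ofReal_comp.mul_const _
  have hd := ((hw.const_mul (conj (v.base : ℂ))).const_sub (v.base : ℂ)).div
    (hw.const_sub 1) hne
  refine hd.congr_deriv ?_
  have hz : (v.base : ℂ) - conj (v.base : ℂ) = 2 * (v.base.im : ℂ) * Complex.I := by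
    rw [Complex.sub_conj]; simp
  have hz' : (v.base : ℂ) = conj (v.base : ℂ) + 2 * (v.base.im : ℂ) * Complex.I := by
    rw [← hz]; ring
  rw [flowH_dir]
  congr 1
  generalize discPoint t v = w
  generalize conj (v.base : ℂ) = z' at hz hz' ⊢
  rw [hz']
  push_cast
  field_simp
  ring_nf
  simp only [Complex.I_sq]
  ring

theorem discPoint_smul (t : ℝ) (g : SL(2, ℤ)) (v : T1H) :
    discPoint t (g • v) = discPoint t v * factor g (conj (v.base : ℂ)) / factor g v.base := by
  have h := factor_ne_zero g v.base
  have hc : conj (factor g v.base) = factor g (conj (v.base : ℂ)) := by simp [factor]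
  have hn : ((‖factor g v.base‖ ^ 2 : ℝ) : ℂ) =
      factor g v.base * factor g (conj (v.base : ℂ)) := by
    rw [← hc, Complex.mul_conj, Complex.normSq_eq_norm_sq]
  have hi : (v.base.im : ℂ) ≠ 0 := Complex.ofReal_ne_zero.mpr v.base.im_pos.ne'
  have hc0 : factor g (conj (v.base : ℂ)) ≠ 0 := by
    rw [← hc]; simpa using h
  rw [discPoint, discPoint, smul_base, smul_dir, im_smul_eq, Complex.ofReal_div, hn]
  field_simp

/-- The geodesic flow commutes with the action of the modular group. -/
theorem flowH_smul (t : ℝ) (g : SL(2, ℤ)) (v : T1H) : flowH t (g • v) = g • flowH t v := by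
  have h := factor_ne_zero g v.base
  have hne := one_sub_discPoint_ne t v
  have hc : conj (factor g v.base) = factor g (conj (v.base : ℂ)) := by simp [factor]
  have hc0 : factor g (conj (v.base : ℂ)) ≠ 0 := by rw [← hc]; simpa using h
  have hne' := one_sub_discPoint_ne t (g • v)
  have hF : factor g (flowH t v).base =
      (factor g v.base - factor g (conj (v.base : ℂ)) * discPoint t v) /
        (1 - discPoint t v) := by
    rw [flowH_base, factor, factor, factor]; field_simp; ring
  have hW : 1 - discPoint t (g • v) =
      (factor g v.base - factor g (conj (v.base : ℂ)) * discPoint t v) / factor g v.base := by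
    rw [discPoint_smul]; field_simp
  have hE : factor g v.base - factor g (conj (v.base : ℂ)) * discPoint t v ≠ 0 := by
    intro h0; rw [h0, zero_div] at hW; exact hne' hW
  apply T1H.ext
  · apply UpperHalfPlane.ext
    rw [flowH_base, smul_base, smul_base, coe_smul_eq g (flowH t v).base, hF, hW, coe_smul_eq,
      discPoint_smul, flowH_base]
    have hcc : conj ((((g 0 0 : ℤ) : ℂ) * v.base + ((g 0 1 : ℤ) : ℂ)) / factor g v.base) =
        (((g 0 0 : ℤ) : ℂ) * conj (v.base : ℂ) + ((g 0 1 : ℤ) : ℂ)) /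
          factor g (conj (v.base : ℂ)) := by
      rw [map_div₀, hc]; simp
    rw [hcc]
    field_simp
    ring
  · rw [flowH_dir, smul_dir, smul_dir, hF, hW, flowH_dir]
    field_simp

/-- The geodesic flow `g_t` on `T¹M`, i.e. `g_t (π v) = π (g_t v)`. -/
def flow (t : ℝ) : T1M → T1M :=
  Quotient.map (sa := MulAction.orbitRel SL(2, ℤ) T1H) (sb := MulAction.orbitRel SL(2, ℤ) T1H)
    (flowH t) (by
      rintro v w ⟨g, rfl⟩
      exact ⟨g, (flowH_smul t g w).symm⟩)

theorem flow_proj (t : ℝ) (v : T1H) : flow t (proj v) = proj (flowH t v) := rfl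

/-- `x` is the attracting (forward) endpoint of the oriented geodesic of `ℍ` with initial unit
tangent vector `v`. -/
def IsAttractingEndpoint (v : T1H) (x : ℝ) : Prop :=
  Tendsto (fun t : ℝ => ((flowH t v).base : ℂ)) atTop (𝓝 (x : ℂ))

/-! ### Frequency of visits to the cusp -/

/-- The neighbourhood `π ({Im z > d} × S¹)` of the cusp in `T¹M`. -/
def cuspNhd (d : ℝ) : Set T1M := proj '' {v : T1H | d < v.base.im}

/-- The proportion `(1/T) ∫₀ᵀ χ_d (g_t v) dt` of the time in `[0, T]` spent in `cuspNhd d`. -/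
def cuspProportion (d : ℝ) (v : T1M) (T : ℝ) : ℝ :=
  (1 / T) * ∫ t in (0 : ℝ)..T, (cuspNhd d).indicator (fun _ => (1 : ℝ)) (flow t v)

/-- The forward orbit `{g_t v}_{t ≥ 0}` visits the cusp with frequency `0`. -/
def VisitsCuspWithFreqZero (v : T1M) : Prop :=
  ∃ d : ℝ, 1 < d ∧ Tendsto (cuspProportion d v) atTop (𝓝 0)

/-- The forward orbit `{g_t v}_{t ≥ 0}` visits the cusp with frequency `1`. -/
def VisitsCuspWithFreqOne (v : T1M) : Prop :=
  ∀ d : ℝ, 1 < d → Tendsto (cuspProportion d v) atTop (𝓝 1)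

/-! ### `(a,b)`-continued fractions -/

/-- The generalized integral part `[x]_{a,b}`. In the last case it is `⌈x - b⌉` with the
convention `⌈y⌉ = ⌊y⌋ + 1`. -/
def intPart (a b x : ℝ) : ℤ :=
  if x < a then ⌊x - a⌋ else if x < b then 0 else ⌊x - b⌋ + 1

/-- The complete quotients `x_0 = x`, `x_{j+1} = -1 / (x_j - [x_j]_{a,b})`. -/
def completeQuotient (a b x : ℝ) : ℕ → ℝ
  | 0 => x
  | j + 1 => -1 / (completeQuotient a b x j - intPart a b (completeQuotient a b x j))

/-- The partial quotients `a_j = [x_j]_{a,b}` of `x = [a_0, a_1, a_2, …]_{a,b}`. -/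
def partialQuotient (a b x : ℝ) (j : ℕ) : ℤ := intPart a b (completeQuotient a b x j)

/-- The modified partial quotients `a_j^ξ`. -/
def modifiedQuotient (a b x ξ : ℝ) (j : ℕ) : ℤ :=
  if ξ < |(partialQuotient a b x j : ℝ)| then partialQuotient a b x j else 1

/-- `A_N = (1/N) ∑_{j<N} log |a_j|` (a possible initial term with `a_0 = 0` counts as `0`). -/
def logAverage (a b x : ℝ) (N : ℕ) : ℝ :=
  (1 / (N : ℝ)) * ∑ j ∈ Finset.range N, Real.log |(partialQuotient a b x j : ℝ)|

/-- `A_N^ξ = (1/N) ∑_{j<N} log |a_j^ξ|`. -/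
def modifiedLogAverage (a b x ξ : ℝ) (N : ℕ) : ℝ :=
  (1 / (N : ℝ)) * ∑ j ∈ Finset.range N, Real.log |(modifiedQuotient a b x ξ j : ℝ)|

/-! ### The set `𝒮` of parameters -/

/-- The parameter set `𝒫`. -/
def paramP : Set (ℝ × ℝ) := {p | -1 ≤ p.1 ∧ p.1 < 0 ∧ 0 < p.2 ∧ p.2 ≤ 1 ∧ 1 ≤ p.2 - p.1}

/-- The slow map `f_{a,b}` of `ℝ ∪ {∞}`: it is `x ↦ x + 1` for `x < a`, `x ↦ -1/x` for
`a ≤ x < b` (sending `0` to `∞`), `x ↦ x - 1` for `x ≥ b`, and it fixes `∞`. -/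
def slowMap (a b : ℝ) : OnePoint ℝ → OnePoint ℝ
  | none => OnePoint.infty
  | some x =>
    if x < a then ((x + 1 : ℝ) : OnePoint ℝ)
    else if x < b then (if x = 0 then OnePoint.infty else ((-1 / x : ℝ) : OnePoint ℝ))
    else ((x - 1 : ℝ) : OnePoint ℝ)

/-- The forward orbit of `y` under `f` is eventually periodic. -/
def EventuallyPeriodic {α : Type*} (f : α → α) (y : α) : Prop :=
  ∃ m p : ℕ, 0 < p ∧ f^[m + p] y = f^[m] y

/-- The orbits of `y` and `z` under `f` are both eventually periodic or they meet. -/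
def PeriodicOrMeet {α : Type*} (f : α → α) (y z : α) : Prop :=
  (EventuallyPeriodic f y ∧ EventuallyPeriodic f z) ∨ ∃ m k : ℕ, f^[m] y = f^[k] z

/-- The finiteness condition on `f_{a,b}`: for `a` the upper orbit (that of `-1/a`) and the lower
orbit (that of `a + 1`), and for `b` the upper orbit (that of `b - 1`) and the lower orbit (that
of `-1/b`), are either both eventually periodic or meet, forming a cycle. -/
def FinitenessCondition (a b : ℝ) : Prop :=
  PeriodicOrMeet (slowMap a b) ((-1 / a : ℝ) : OnePoint ℝ) ((a + 1 : ℝ) : OnePoint ℝ) ∧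
  PeriodicOrMeet (slowMap a b) ((b - 1 : ℝ) : OnePoint ℝ) ((-1 / b : ℝ) : OnePoint ℝ)

/-- `𝒮 = 𝒫 \ ℰ`, where `ℰ` is the set of parameters violating the finiteness condition. -/
def paramS : Set (ℝ × ℝ) := {p | p ∈ paramP ∧ FinitenessCondition p.1 p.2}

end CuspExcursion

end

open CuspExcursion

noncomputable section

open Filter Topology
open scoped UpperHalfPlane MatrixGroups ComplexConjugate

namespace CuspExcursion

/-! ### One step of the `(a,b)`-continued fraction algorithm -/

/-! The ray of the lifted vector stays within bounded distance, time by time, of the vertical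
geodesic `x + i e^{-t}` (`exists_dist_verticalRay_le`), so excursions into the cusp can be read off
the latter with bounded errors. From the cusp `p_n / q_n` the point `x + i e^{-t}` has height `1 /
Q_n(t)` with `Q_n(t) = q_n² e^{-t} + (q_n x - p_n)² e^t`. The forms `e_n = q_{n-1} x - p_{n-1}`
satisfy `|e_n| = 1 / |x_1 ⋯ x_n|`; put `t_n = -2 log |e_n|`. The arithmetic core is
`convDen_mul_convErr_bounds`: `|q_n e_n|` lies between positive constants. It makes `Q_n(t)`
comparable to `e^{t_n - t} + e^{t - t_{n+1}}`. Hence on `[t_n, t_{n+1}]` the height exceeds a large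
`d` exactly on `[t_n + log d, t_{n+1} - log d]`, up to bounded errors, because no other cusp is then
seen at large height (`convForm_le_of_im_smul`). Moreover `t_{n+1} - t_n = 2 log |x_{n+1}| = 2 log
|a_{n+1}| + O(1)`, and two consecutive steps together have length bounded below. `ExcursionPattern`
records these facts. What remains is real analysis: frequency zero means that the long excursions
carry a negligible sum, frequency one that the mean excursion length is infinite. -/

theorem sub_intPart_mem {a b : ℝ} (hab : 1 ≤ b - a) (y : ℝ) :
    a ≤ y - intPart a b y ∧ y - intPart a b y < b := by
  have h1 := Int.floor_le (y - a)
  have h2 := Int.lt_floor_add_one (y - a)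
  have h3 := Int.floor_le (y - b)
  have h4 := Int.lt_floor_add_one (y - b)
  unfold intPart
  split_ifs with h h' <;> push_cast <;> constructor <;> linarith

/-- The floor puts the remainder into `[a, a + 1)`, which may be smaller than `[a, b)`. This sharper
bound, and its mirror image for `y ≥ b`, controls successive quotients of equal sign. -/
theorem intPart_of_lt {a b y : ℝ} (h : y < a) :
    intPart a b y < 0 ∧ y - intPart a b y < a + 1 := by
  have h2 := Int.lt_floor_add_one (y - a)
  rw [intPart, if_pos h]
  exact ⟨Int.floor_lt.mpr (by push_cast; linarith), by linarith⟩

theorem intPart_of_ge {a b y : ℝ} (hab : 1 ≤ b - a) (h : b ≤ y) :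
    0 < intPart a b y ∧ b - 1 ≤ y - intPart a b y := by
  have h1 := Int.floor_le (y - b)
  have h2 : 0 ≤ ⌊y - b⌋ := Int.floor_nonneg.mpr (by linarith)
  rw [intPart, if_neg (by linarith), if_neg (by linarith)]
  exact ⟨by omega, by push_cast; linarith⟩

theorem irrational_next {a b y : ℝ} (hy : Irrational y) :
    Irrational (-1 / (y - intPart a b y)) := by
  have h : Irrational (y - intPart a b y) := hy.sub_intCast _
  have := h.inv.neg
  rwa [neg_div, one_div]

/-- The remainder lies in `[a, b) ⊆ [-1, 1)`; irrationality excludes `0` and the endpoint `-1`,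
which can occur when `a = -1`. -/
theorem one_lt_abs_next {a b y : ℝ} (hp : (a, b) ∈ paramP) (hy : Irrational y) :
    1 < |-1 / (y - intPart a b y)| := by
  obtain ⟨h1, h2, h3, h4, h5⟩ := hp
  simp only at h1 h2 h3 h4 h5
  have h : Irrational (y - intPart a b y) := hy.sub_intCast _
  have hm := sub_intPart_mem h5 y
  have h0 : y - intPart a b y ≠ 0 := h.ne_zero
  have hn : y - intPart a b y ≠ -1 := by simpa using h.ne_int (-1)
  rw [abs_div, abs_neg, abs_one, one_lt_div (abs_pos.mpr h0), abs_lt]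
  exact ⟨lt_of_le_of_ne (by linarith) hn.symm, by linarith⟩

theorem mul_intPart_pos {a b y : ℝ} (hp : (a, b) ∈ paramP) (hy : 1 < |y|) :
    0 < y * intPart a b y := by
  obtain ⟨h1, h2, h3, h4, h5⟩ := hp
  simp only at h1 h2 h3 h4 h5
  rcases lt_abs.mp hy with h | h
  · have := (intPart_of_ge h5 (show b ≤ y by linarith)).1
    have : (0 : ℝ) < intPart a b y := by exact_mod_cast this
    exact mul_pos (by linarith) this
  · have := (intPart_of_lt (b := b) (show y < a by linarith)).1
    have : (intPart a b y : ℝ) < 0 := by exact_mod_cast this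
    exact mul_pos_of_neg_of_neg (by linarith) this

/-- The margin by which complete quotients with a digit of the same sign before them stay away
from `±1`. -/
def margin (a b : ℝ) : ℝ := min b (-a)

theorem margin_pos {a b : ℝ} (hp : (a, b) ∈ paramP) : 0 < margin a b :=
  lt_min hp.2.2.1 (neg_pos.mpr hp.2.1)

/-- A complete quotient that has the same sign as the previous one has modulus at least
`1 + margin a b` and a digit different from `±1`. -/
theorem next_of_same_sign {a b y : ℝ} (hp : (a, b) ∈ paramP) (hy1 : 1 < |y|)
    (hs : 0 < y * (-1 / (y - intPart a b y))) :
    1 + margin a b ≤ |-1 / (y - intPart a b y)| ∧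
      2 ≤ |intPart a b (-1 / (y - intPart a b y))| := by
  obtain ⟨h1, h2, h3, h4, h5⟩ := hp
  simp only at h1 h2 h3 h4 h5
  rcases lt_abs.mp hy1 with hy0 | hy0
  · have hm := (intPart_of_ge h5 (show b ≤ y by linarith)).2
    have hpos : 0 < -1 / (y - intPart a b y) := pos_of_mul_pos_right hs (by linarith)
    have hneg : y - intPart a b y < 0 := by
      by_contra hc
      exact absurd hpos (not_lt.mpr (div_nonpos_of_nonpos_of_nonneg (by norm_num) (by linarith)))
    -- The remainder lies in `[b - 1, 0)`, and `(1 + b) (b - 1) = b² - 1 > -1`.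
    have key : 1 + b ≤ -1 / (y - intPart a b y) := by
      rw [le_div_iff_of_neg hneg]
      nlinarith
    refine ⟨(le_trans ?_ key).trans (le_abs_self _), ?_⟩
    · have := min_le_left b (-a); unfold margin; linarith
    · generalize -1 / (y - intPart a b y) = z at key
      refine le_trans ?_ (le_abs_self _)
      rw [intPart, if_neg (by linarith), if_neg (by linarith)]
      have : 1 ≤ ⌊z - b⌋ := Int.le_floor.mpr (by push_cast; linarith)
      omega
  · have hm := (intPart_of_lt (b := b) (show y < a by linarith)).2
    have hneg' : -1 / (y - intPart a b y) < 0 := neg_of_mul_pos_right hs (by linarith)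
    have hpos : 0 < y - intPart a b y := by
      by_contra hc
      exact absurd hneg' (not_lt.mpr (div_nonneg_of_nonpos (by norm_num) (by linarith)))
    have key : -1 / (y - intPart a b y) ≤ a - 1 := by
      rw [div_le_iff₀ hpos]
      nlinarith
    refine ⟨(le_trans ?_ (neg_le_neg key)).trans (neg_le_abs _), ?_⟩
    · have := min_le_right b (-a); unfold margin; linarith
    -- Strictness matters here: at exactly `a - 1` the floor convention would give the digit `-1`.
    · have hlt : -1 / (y - intPart a b y) < a - 1 := by
        refine lt_of_le_of_ne key fun he => ?_
        rw [div_eq_iff hpos.ne'] at he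
        nlinarith
      generalize -1 / (y - intPart a b y) = z at hlt
      refine le_trans ?_ (neg_le_abs _)
      rw [intPart, if_pos (by linarith)]
      have : ⌊z - a⌋ < -1 := Int.floor_lt.mpr (by push_cast; linarith)
      omega

/-- Two consecutive steps of the algorithm expand by a definite factor. -/
theorem one_add_margin_le_mul_next {a b y : ℝ} (hp : (a, b) ∈ paramP) (hy : Irrational y)
    (hy1 : 1 < |y|) : 1 + margin a b ≤ |y| * |-1 / (y - intPart a b y)| := by
  have hn := one_lt_abs_next hp hy
  by_cases hc : 1 + margin a b ≤ |y|
  · nlinarith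
  push Not at hc
  obtain ⟨h1, h2, h3, h4, h5⟩ := hp
  simp only at h1 h2 h3 h4 h5
  have hcb : margin a b ≤ b := min_le_left _ _
  have hca : margin a b ≤ -a := min_le_right _ _
  -- Now `|y| < 1 + margin a b ≤ 2`, so the digit is `±1` and the product is `|y| / (|y| - 1) ≥ 2`.
  suffices h : 2 ≤ |y| * |-1 / (y - intPart a b y)| by linarith
  rcases lt_abs.mp hy1 with hy0 | hy0
  · rw [abs_of_pos (by linarith)] at hc
    have hk : intPart a b y = 1 := by
      rw [intPart, if_neg (by linarith), if_neg (by linarith)]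
      have : ⌊y - b⌋ = 0 := Int.floor_eq_zero_iff.mpr ⟨by linarith, by linarith⟩
      omega
    rw [hk, abs_div, abs_neg, abs_one, abs_of_pos (show 0 < y by linarith)]
    push_cast
    rw [abs_of_pos (by linarith), ← mul_div_assoc, le_div_iff₀ (by linarith)]
    linarith
  · rw [abs_of_neg (by linarith)] at hc
    have hk : intPart a b y = -1 := by
      rw [intPart, if_pos (by linarith)]
      exact Int.floor_eq_iff.mpr ⟨by push_cast; linarith, by push_cast; linarith⟩
    rw [hk, abs_div, abs_neg, abs_one, abs_of_neg (show y < 0 by linarith)]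
    push_cast
    rw [abs_of_neg (by linarith), ← mul_div_assoc, le_div_iff₀ (by linarith)]
    linarith

/-- A digit and its complete quotient agree up to a factor `2`. -/
theorem abs_intPart_bounds {a b y : ℝ} (hp : (a, b) ∈ paramP) (hy1 : 1 < |y|) :
    1 ≤ |(intPart a b y : ℝ)| ∧ |(intPart a b y : ℝ)| ≤ 2 * |y| ∧
      |y| ≤ 2 * |(intPart a b y : ℝ)| := by
  have hk : intPart a b y ≠ 0 := by
    intro h; have := mul_intPart_pos hp hy1; rw [h] at this; simp at this
  have hk1 : (1 : ℝ) ≤ |(intPart a b y : ℝ)| := by exact_mod_cast Int.one_le_abs hk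
  have hd : |y - intPart a b y| ≤ 1 := by
    have hm := sub_intPart_mem hp.2.2.2.2 y
    have h1 : -1 ≤ a := hp.1
    have h4 : b ≤ 1 := hp.2.2.2.1
    exact abs_le.mpr ⟨by linarith, by linarith⟩
  have h1 := abs_sub_abs_le_abs_sub y (intPart a b y)
  have h2 := abs_sub_abs_le_abs_sub (intPart a b y : ℝ) y
  rw [abs_sub_comm] at h2
  exact ⟨hk1, by linarith, by linarith⟩

/-! ### Convergents -/

/-- Numerators of the convergents, shifted by one: `p_{n-1}`. -/
def convNum (a b x : ℝ) : ℕ → ℤ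
  | 0 => 1
  | 1 => partialQuotient a b x 0
  | n + 2 => partialQuotient a b x (n + 1) * convNum a b x (n + 1) - convNum a b x n

/-- Denominators of the convergents, shifted by one: `q_{n-1}`. -/
def convDen (a b x : ℝ) : ℕ → ℤ
  | 0 => 0
  | 1 => 1
  | n + 2 => partialQuotient a b x (n + 1) * convDen a b x (n + 1) - convDen a b x n

/-- The linear forms `q_{n-1} x - p_{n-1}`. -/
def convErr (a b x : ℝ) (n : ℕ) : ℝ := convDen a b x n * x - convNum a b x n

theorem conv_det (a b x : ℝ) (n : ℕ) :
    convNum a b x n * convDen a b x (n + 1) - convNum a b x (n + 1) * convDen a b x n = 1 := by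
  induction n with
  | zero => simp [convNum, convDen]
  | succ n ih => rw [convNum, convDen]; linarith

theorem convDen_mul_convErr (a b x : ℝ) (n : ℕ) :
    convDen a b x (n + 1) * convErr a b x n - convDen a b x n * convErr a b x (n + 1) = -1 := by
  have h : (convNum a b x n * convDen a b x (n + 1) - convNum a b x (n + 1) * convDen a b x n : ℝ)
      = 1 := by exact_mod_cast conv_det a b x n
  rw [convErr, convErr]; linarith

theorem convErr_zero (a b x : ℝ) : convErr a b x 0 = -1 := by simp [convErr, convNum, convDen]

theorem irrational_completeQuotient {a b x : ℝ} (hx : Irrational x) (n : ℕ) :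
    Irrational (completeQuotient a b x n) := by
  induction n with
  | zero => exact hx
  | succ n ih => exact irrational_next ih

theorem one_lt_abs_completeQuotient {a b x : ℝ} (hp : (a, b) ∈ paramP) (hx : Irrational x)
    (n : ℕ) : 1 < |completeQuotient a b x (n + 1)| :=
  one_lt_abs_next hp (irrational_completeQuotient hx n)

/-- The linear forms inherit the recursion `e_{n+2} = a_{n+1} e_{n+1} - e_n`; dividing by `e_{n+1}`
turns it into the recursion of the complete quotients. Together with `e_0 = -1` this gives `|e_n| =
1 / |x_1 ⋯ x_n|`. -/
theorem convErr_succ {a b x : ℝ} (hx : Irrational x) (n : ℕ) :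
    convErr a b x (n + 1) ≠ 0 ∧
      convErr a b x n = completeQuotient a b x (n + 1) * convErr a b x (n + 1) := by
  induction n with
  | zero =>
    have h := ((irrational_completeQuotient (a := a) (b := b) hx 0).sub_intCast
      (partialQuotient a b x 0)).ne_zero
    have e : convErr a b x 1 = completeQuotient a b x 0 - partialQuotient a b x 0 := by
      simp [convErr, convNum, convDen, completeQuotient]
    rw [zero_add, e, convErr_zero]
    refine ⟨h, ?_⟩
    change _ = -1 / (completeQuotient a b x 0 - partialQuotient a b x 0) * _
    field_simp
  | succ n ih =>
    have h := ((irrational_completeQuotient (a := a) (b := b) hx (n + 1)).sub_intCast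
      (partialQuotient a b x (n + 1))).ne_zero
    have e : convErr a b x (n + 2) =
        -(completeQuotient a b x (n + 1) - partialQuotient a b x (n + 1)) *
          convErr a b x (n + 1) := by
      have : convErr a b x (n + 2) =
          partialQuotient a b x (n + 1) * convErr a b x (n + 1) - convErr a b x n := by
        simp only [convErr, convNum, convDen]; push_cast; ring
      rw [this, ih.2]; ring
    refine ⟨by rw [e]; exact mul_ne_zero (neg_ne_zero.mpr h) ih.1, ?_⟩
    rw [e]
    change _ = -1 / (completeQuotient a b x (n + 1) - partialQuotient a b x (n + 1)) * _
    field_simp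

theorem convErr_ne_zero {a b x : ℝ} (hx : Irrational x) (n : ℕ) : convErr a b x n ≠ 0 := by
  cases n with
  | zero => rw [convErr_zero]; norm_num
  | succ n => exact (convErr_succ hx n).1

/-- The denominators have nondecreasing moduli, and consecutive ones have the same sign if and
only if the digit in between is positive. -/
theorem convDen_step {a b x : ℝ} (hp : (a, b) ∈ paramP) (hx : Irrational x) (n : ℕ) :
    convDen a b x (n + 1) ≠ 0 ∧ |convDen a b x n| ≤ |convDen a b x (n + 1)| ∧
      (0 < convDen a b x n * convDen a b x (n + 1) * completeQuotient a b x (n + 1) →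
        1 + margin a b ≤ |completeQuotient a b x (n + 1)| ∧
          2 ≤ |partialQuotient a b x (n + 1)|) ∧
      0 < convDen a b x (n + 1) * convDen a b x (n + 2) * completeQuotient a b x (n + 1) := by
  have step : ∀ m, convDen a b x (m + 1) ≠ 0 → |convDen a b x m| ≤ |convDen a b x (m + 1)| →
      (0 < convDen a b x m * convDen a b x (m + 1) * completeQuotient a b x (m + 1) →
          2 ≤ |partialQuotient a b x (m + 1)|) →
      convDen a b x (m + 2) ≠ 0 ∧ |convDen a b x (m + 1)| ≤ |convDen a b x (m + 2)| ∧
      0 < convDen a b x (m + 1) * convDen a b x (m + 2) * completeQuotient a b x (m + 1) := by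
    intro m h0 hle h2
    have hx1 := one_lt_abs_completeQuotient hp hx m
    have hs : 0 < completeQuotient a b x (m + 1) * partialQuotient a b x (m + 1) :=
      mul_intPart_pos hp hx1
    have hrec : convDen a b x (m + 2) =
      partialQuotient a b x (m + 1) * convDen a b x (m + 1) - convDen a b x m := by rw [convDen]
    have hq2 : 0 < convDen a b x (m + 1) ^ 2 := by positivity
    have hcross : |convDen a b x m * convDen a b x (m + 1)| ≤ convDen a b x (m + 1) ^ 2 := by
      rw [abs_mul, ← sq_abs, sq]; gcongr
    generalize completeQuotient a b x (m + 1) = y at *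
    generalize partialQuotient a b x (m + 1) = k at *
    generalize convDen a b x (m + 2) = r at *
    generalize convDen a b x (m + 1) = q at *
    generalize convDen a b x m = p at *
    -- The recursion gives `q r = k q² - p q` with `|p q| ≤ q²`. Cancellation occurs only if `p q`
    -- has the sign of `k`, and in that case `|k| ≥ 2` leaves at least `q²`.
    have hcases : (0 < y ∧ q ^ 2 ≤ q * r) ∨ (y < 0 ∧ q * r ≤ - q ^ 2) := by
      have e : q * r = k * q ^ 2 - p * q := by rw [hrec]; ring
      rcases pos_and_pos_or_neg_and_neg_of_mul_pos hs with ⟨hy, hk⟩ | ⟨hy, hk⟩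
      · left
        have hk' : 0 < k := by exact_mod_cast hk
        refine ⟨hy, ?_⟩
        by_cases hpq : 0 < p * q
        · have : (0 : ℝ) < p * q * y := mul_pos (by exact_mod_cast hpq) hy
          have := h2 this
          rw [abs_of_pos hk'] at this
          have := (abs_le.mp hcross).2
          nlinarith
        · nlinarith
      · right
        have hk' : k < 0 := by exact_mod_cast hk
        refine ⟨hy, ?_⟩
        by_cases hpq : p * q < 0
        · have : (0 : ℝ) < p * q * y := mul_pos_of_neg_of_neg (by exact_mod_cast hpq) hy
          have := h2 this
          rw [abs_of_neg hk'] at this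
          have := (abs_le.mp hcross).1
          nlinarith
        · nlinarith
    have habs : q ^ 2 ≤ |q * r| := by
      rcases hcases with h | h
      · exact h.2.trans (le_abs_self _)
      · exact (le_neg.mp h.2).trans (neg_le_abs _)
    refine ⟨?_, ?_, ?_⟩
    · rintro rfl; simp at habs; exact absurd habs h0
    · rw [abs_mul, ← sq_abs, sq] at habs
      exact le_of_mul_le_mul_left habs (abs_pos.mpr h0)
    · rcases hcases with ⟨hy, h⟩ | ⟨hy, h⟩
      · have : (0 : ℝ) < q * r := by exact_mod_cast hq2.trans_le h
        exact mul_pos this hy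
      · have : (q * r : ℝ) < 0 := by exact_mod_cast (by linarith : q * r < 0)
        exact mul_pos_of_neg_of_neg this hy
  induction n with
  | zero =>
    have h0 : convDen a b x 0 = 0 := rfl
    have h1 : convDen a b x 1 = 1 := rfl
    have := step 0 (by simp [h1]) (by simp [h0]) (by simp [h0])
    exact ⟨by simp [h1], by simp [h0], by simp [h0], this.2.2⟩
  | succ n ih =>
    obtain ⟨i1, i2, i3, i4⟩ := ih
    have s := step n i1 i2 fun h => (i3 h).2
    -- By `i4` the product of the two denominators has the sign of `x_{n+1}`. The hypothesis
    -- therefore says that `x_{n+1}` and `x_{n+2}` have equal signs, which is the case treated by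
    -- `next_of_same_sign`.
    have same : 0 < convDen a b x (n + 1) * convDen a b x (n + 2) *
        completeQuotient a b x (n + 2) →
        1 + margin a b ≤ |completeQuotient a b x (n + 2)| ∧
          2 ≤ |partialQuotient a b x (n + 2)| := by
      intro h
      refine next_of_same_sign hp
        (one_lt_abs_completeQuotient hp hx n) ?_
      change 0 < completeQuotient a b x (n + 1) * completeQuotient a b x (n + 2)
      have h' := mul_pos i4 h
      have e : ((convDen a b x (n + 1) : ℝ) * convDen a b x (n + 2) *
        completeQuotient a b x (n + 1)) * ((convDen a b x (n + 1) : ℝ) * convDen a b x (n + 2) *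
        completeQuotient a b x (n + 2)) = (completeQuotient a b x (n + 1) *
        completeQuotient a b x (n + 2)) * ((convDen a b x (n + 1) : ℝ) * convDen a b x (n + 2)) ^ 2
          := by ring
      rw [e] at h'
      exact pos_of_mul_pos_left h' (sq_nonneg _)
    exact ⟨s.1, s.2.1, same, (step (n + 1) s.1 s.2.1 fun h => (same h).2).2.2⟩

/-- The product `q_n |q_{n-1} x - p_{n-1}|` is bounded from below and from above. -/
theorem convDen_mul_convErr_bounds {a b x : ℝ} (hp : (a, b) ∈ paramP) (hx : Irrational x)
    (n : ℕ) : 1 / 2 ≤ |convDen a b x (n + 1) * convErr a b x n| ∧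
      |convDen a b x (n + 1) * convErr a b x n| ≤ 1 + 1 / margin a b := by
  have hc := margin_pos hp
  obtain ⟨h0, hle, hsame, -⟩ := convDen_step hp hx n
  have hy1 := one_lt_abs_completeQuotient hp hx n
  have hdet := convDen_mul_convErr a b x n
  obtain ⟨he0, he⟩ := convErr_succ (a := a) (b := b) hx n
  have hle' : |(convDen a b x n : ℝ)| ≤ |(convDen a b x (n + 1) : ℝ)| := by exact_mod_cast hle
  have hq0 : (convDen a b x (n + 1) : ℝ) ≠ 0 := by exact_mod_cast h0
  generalize completeQuotient a b x (n + 1) = y at *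
  generalize convErr a b x (n + 1) = e' at *
  generalize convErr a b x n = e at *
  generalize (convDen a b x (n + 1) : ℝ) = q at *
  generalize (convDen a b x n : ℝ) = p at *
  have hy0 : 0 < |y| := by linarith
  have hB : |p * e'| * |y| ≤ |q * e| := by
    rw [he, abs_mul, abs_mul, abs_mul]
    nlinarith [mul_le_mul_of_nonneg_right hle' (mul_nonneg hy0.le (abs_nonneg e'))]
  have hB1 : |p * e'| ≤ |q * e| := by nlinarith [abs_nonneg (p * e')]
  -- The terms `q e` and `p e'` differ by `1`, and the first dominates: hence the bound `1 / 2`.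
  constructor
  · have : |q * e - p * e'| = 1 := by rw [hdet]; simp
    have := abs_sub (q * e) (p * e')
    linarith
  -- Since `e = y e'`, this is the sign of `(q e) (p e')`. With equal signs, the margin in `|y|`
  -- forces `|p e'| ≤ 1 / margin a b`; otherwise the moduli do not cancel and `|q e| ≤ 1`.
  · by_cases hs : 0 < p * q * y
    · have hy := (hsame hs).1
      have h1 : |q * e| ≤ 1 + |p * e'| := by
        have := abs_sub_abs_le_abs_sub (q * e) (p * e')
        rw [hdet, abs_neg, abs_one] at this; linarith
      have h2 : |p * e'| * (1 + margin a b) ≤ |q * e| :=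
        (mul_le_mul_of_nonneg_left hy (abs_nonneg _)).trans hB
      have h3 : |p * e'| ≤ 1 / margin a b := by
        rw [le_div_iff₀ hc]; linarith
      linarith
    · have h2 : (q * e) * (p * e') ≤ 0 := by
        rw [he]; nlinarith [mul_nonneg (sub_nonneg.mpr (not_lt.mp hs)) (sq_nonneg e')]
      have h3 : 0 < 1 / margin a b := by positivity
      have h4 : |q * e| ≤ 1 := by
        rw [← sq_le_one_iff_abs_le_one]
        nlinarith [sq_nonneg (p * e')]
      linarith


/-! ### Comparison of a geodesic ray with the vertical geodesic to the same endpoint -/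

/-- The point `x + i e^{-t}` on the vertical geodesic to `x`. -/
def verticalRay (x t : ℝ) : ℍ := ⟨⟨x, Real.exp (-t)⟩, Real.exp_pos _⟩

theorem coe_verticalRay (x t : ℝ) : (verticalRay x t : ℂ) = ⟨x, Real.exp (-t)⟩ := rfl

theorem verticalRay_im (x t : ℝ) : (verticalRay x t).im = Real.exp (-t) := rfl

theorem one_sub_tanh_half (t : ℝ) : 1 - Real.tanh (t / 2) = 2 / (Real.exp t + 1) := by
  have h : Real.exp t = Real.exp (t / 2) * Real.exp (t / 2) := by rw [← Real.exp_add]; ring_nf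
  rw [Real.tanh_eq, Real.exp_neg, h]
  have := Real.exp_pos (t / 2)
  field_simp
  ring

theorem tendsto_tanh_half : Tendsto (fun t : ℝ => Real.tanh (t / 2)) atTop (𝓝 1) := by
  have h : Tendsto (fun t : ℝ => 1 - 2 / (Real.exp t + 1)) atTop (𝓝 (1 - 0)) :=
    tendsto_const_nhds.sub
      ((tendsto_atTop_add_const_right _ _ Real.tendsto_exp_atTop).const_div_atTop 2)
  rw [sub_zero] at h
  refine h.congr fun t => ?_
  rw [← one_sub_tanh_half]; ring

/-- A geodesic ray stays within bounded distance of the vertical geodesic to its endpoint. -/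
theorem exists_dist_verticalRay_le {v : T1H} {x : ℝ} (hx : IsAttractingEndpoint v x) :
    ∃ K : ℝ, 0 ≤ K ∧ ∀ t : ℝ, 0 ≤ t → dist (flowH t v).base (verticalRay x t) ≤ K := by
  set w : ℂ := -Complex.I * v.dir / (v.base.im : ℂ) with hw
  set z : ℂ := (v.base : ℂ) with hz
  set y : ℝ := v.base.im with hy
  have hy0 : 0 < y := v.base.im_pos
  have hwn : ‖w‖ = 1 := norm_unit v
  have hτ : Tendsto (fun t : ℝ => ((Real.tanh (t / 2) : ℝ) : ℂ)) atTop (𝓝 ((1 : ℝ) : ℂ)) :=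
    (Complex.continuous_ofReal.tendsto 1).comp tendsto_tanh_half
  rw [Complex.ofReal_one] at hτ
  have hzz : ‖z - conj z‖ = 2 * y := by
    rw [Complex.sub_conj]; simp [hz, hy, abs_of_pos v.base.im_pos]
  have hden : Tendsto (fun t : ℝ => 1 - discPoint t v) atTop (𝓝 (1 - w)) := by
    simpa [discPoint, hw] using (hτ.mul_const w).const_sub 1
  have hnum : Tendsto (fun t : ℝ => z - conj z * discPoint t v) atTop (𝓝 (z - conj z * w)) := by
    simpa [discPoint, hw] using ((hτ.mul_const w).const_mul (conj z)).const_sub z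
  -- The endpoint is the image of the boundary point `w` under the isometry from the disc. The value
  -- `w = 1` would correspond to the endpoint `∞`, incompatible with a finite `x`.
  have hlim : (x : ℂ) * (1 - w) = z - conj z * w := by
    refine tendsto_nhds_unique (hx.mul hden) (hnum.congr fun t => ?_)
    rw [flowH_base, div_mul_cancel₀ _ (one_sub_discPoint_ne t v)]
  have hw1 : 1 - w ≠ 0 := by
    intro h
    have hw1 : w = 1 := (sub_eq_zero.mp h).symm
    rw [hw1] at hlim
    simp only [sub_self, mul_zero, mul_one] at hlim
    rw [← hlim, norm_zero] at hzz
    linarith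
  set r : ℝ := ‖1 - w‖ with hr
  have hr0 : 0 < r := norm_pos_iff.mpr hw1
  have hx_eq : (x : ℂ) = (z - conj z * w) / (1 - w) := by rw [← hlim, mul_div_cancel_right₀ _ hw1]
  -- In the formula for the hyperbolic distance, the Euclidean distance is at most `(8 y / r² + 1)
  -- e^{-t}` and the product of heights at least `(y / 4) e^{-2t}`; the factors `e^{-t}` cancel.
  refine ⟨2 * Real.arsinh ((8 * y / r ^ 2 + 1) / (2 * √(y / 4))), ?_, fun t ht => ?_⟩
  · have : 0 ≤ Real.arsinh ((8 * y / r ^ 2 + 1) / (2 * √(y / 4))) :=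
      Real.arsinh_nonneg_iff.mpr (by positivity)
    linarith
  set τ : ℝ := Real.tanh (t / 2) with hτd
  have hτ1 : 1 - τ = 2 / (Real.exp t + 1) := one_sub_tanh_half t
  have hE : 1 ≤ Real.exp t := Real.one_le_exp ht
  have hτ1' : 1 - τ ≤ 2 * Real.exp (-t) := by
    rw [hτ1, Real.exp_neg, div_eq_mul_inv]; gcongr; linarith
  have hτ1'' : Real.exp (-t) ≤ 1 - τ := by
    rw [hτ1, Real.exp_neg, ← one_div, div_le_div_iff₀ (by linarith) (by linarith)]; linarith
  have hτ0 : 0 ≤ τ := by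
    have : 2 / (Real.exp t + 1) ≤ 1 := by rw [div_le_one (by linarith)]; linarith
    linarith
  have hdp : discPoint t v = (τ : ℂ) * w := rfl
  have hτw : ‖(τ : ℂ) * w‖ = τ := by rw [norm_mul, hwn, Complex.norm_real, mul_one,
    Real.norm_of_nonneg hτ0]
  have hne : 1 - (τ : ℂ) * w ≠ 0 := one_sub_discPoint_ne t v
  set ρ : ℝ := ‖1 - (τ : ℂ) * w‖ with hρ
  have hρ0 : 0 < ρ := norm_pos_iff.mpr hne
  have hρ2 : ρ ≤ 2 := by
    have := norm_sub_le (1 : ℂ) ((τ : ℂ) * w)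
    rw [hτw, norm_one] at this
    have : 0 < Real.exp (-t) := Real.exp_pos _
    linarith
  have hρ1 : 1 - τ ≤ ρ := by
    have := norm_sub_norm_le (1 : ℂ) ((τ : ℂ) * w)
    rwa [hτw, norm_one] at this
  have hρr : r / 2 ≤ ρ := by
    have e : 1 - w = (1 - (τ : ℂ) * w) - ((1 - τ : ℝ) : ℂ) * w := by push_cast; ring
    have h1 := norm_sub_le (1 - (τ : ℂ) * w) (((1 - τ : ℝ) : ℂ) * w)
    have hn : 0 ≤ 1 - τ := (Real.exp_pos _).le.trans hτ1''
    rw [← e, norm_mul, hwn, Complex.norm_real, mul_one, Real.norm_of_nonneg hn] at h1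
    linarith
  have him : (flowH t v).base.im = y * (1 - τ ^ 2) / ρ ^ 2 := by
    have := im_moebius v.base (discPoint t v)
    rw [norm_discPoint, sq_abs] at this
    exact this
  have him' : y / 4 * Real.exp (-t) ≤ (flowH t v).base.im := by
    rw [him, le_div_iff₀ (by positivity)]
    have h1 : Real.exp (-t) ≤ 1 - τ ^ 2 := by nlinarith [Real.exp_pos (-t)]
    have h2 : ρ ^ 2 ≤ 4 := by nlinarith
    calc y / 4 * Real.exp (-t) * ρ ^ 2 ≤ y / 4 * Real.exp (-t) * 4 := by gcongr
      _ = y * Real.exp (-t) := by ring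
      _ ≤ _ := by gcongr
  have hdx : ‖((flowH t v).base : ℂ) - x‖ ≤ 8 * y / r ^ 2 * Real.exp (-t) := by
    have e : ((flowH t v).base : ℂ) - x =
        -(w * (z - conj z) * ((1 - τ : ℝ) : ℂ)) / ((1 - (τ : ℂ) * w) * (1 - w)) := by
      rw [flowH_base, hdp, hx_eq, ← hz]
      push_cast
      field_simp
      ring
    have hn : 0 ≤ 1 - τ := (Real.exp_pos _).le.trans hτ1''
    rw [e, norm_div, norm_neg, norm_mul, norm_mul, norm_mul, hwn, hzz, Complex.norm_real,
      Real.norm_of_nonneg hn, ← hρ, ← hr, div_le_iff₀ (by positivity)]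
    have : r * r / 2 ≤ ρ * r := by nlinarith
    calc 1 * (2 * y) * (1 - τ) ≤ 1 * (2 * y) * (2 * Real.exp (-t)) := by gcongr
      _ = 8 * y / r ^ 2 * Real.exp (-t) * (r * r / 2) := by field_simp; ring
      _ ≤ _ := by gcongr
  have hd : dist ((flowH t v).base : ℂ) (verticalRay x t : ℂ) ≤
      (8 * y / r ^ 2 + 1) * Real.exp (-t) := by
    have e : ((flowH t v).base : ℂ) - (verticalRay x t : ℂ) =
        (((flowH t v).base : ℂ) - x) - ((Real.exp (-t) : ℝ) : ℂ) * Complex.I := by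
      rw [coe_verticalRay]
      generalize Real.exp (-t) = s
      apply Complex.ext <;> simp
    rw [dist_eq_norm, e]
    refine (norm_sub_le _ _).trans ?_
    rw [norm_mul, Complex.norm_I, Complex.norm_real, Real.norm_of_nonneg (Real.exp_pos _).le]
    linarith
  rw [UpperHalfPlane.dist_eq]
  refine mul_le_mul_of_nonneg_left (Real.arsinh_le_arsinh.mpr ?_) two_pos.le
  rw [verticalRay_im]
  have hsq : √(y / 4) * Real.exp (-t) ≤ √((flowH t v).base.im * Real.exp (-t)) := by
    apply Real.le_sqrt_of_sq_le
    rw [mul_pow, Real.sq_sqrt (by positivity), sq, ← mul_assoc]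
    gcongr
  have hs0 : 0 < √(y / 4) := Real.sqrt_pos.mpr (by positivity)
  have he0 := Real.exp_pos (-t)
  rw [div_le_div_iff₀ (mul_pos two_pos ((mul_pos hs0 he0).trans_le hsq)) (by positivity)]
  calc _ ≤ ((8 * y / r ^ 2 + 1) * Real.exp (-t)) * (2 * √(y / 4)) := by gcongr
    _ = (8 * y / r ^ 2 + 1) * (2 * (√(y / 4) * Real.exp (-t))) := by ring
    _ ≤ _ := by gcongr

/-- `log Im` is 1-Lipschitz for the hyperbolic metric and `g` is an isometry. Passing to a point at
distance at most `K` thus changes every cusp height by a factor at most `e^K`. -/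
theorem im_smul_le_exp_dist_mul (g : SL(2, ℤ)) (z w : ℍ) :
    (g • z).im ≤ Real.exp (dist z w) * (g • w).im := by
  have h : dist (g • z) (g • w) = dist z w :=
    dist_smul (g : SL(2, ℝ)) z w
  have h1 := UpperHalfPlane.dist_log_im_le (g • z) (g • w)
  rw [h, Real.dist_eq] at h1
  have h2 := (abs_le.mp h1).2
  rw [← Real.log_le_log_iff (UpperHalfPlane.im_pos _)
    (mul_pos (Real.exp_pos _) (UpperHalfPlane.im_pos _)),
    Real.log_mul (Real.exp_pos _).ne' (UpperHalfPlane.im_ne_zero _), Real.log_exp]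
  linarith

/-! ### Times spent in the cusp neighbourhood -/

/-- The times at which the orbit of `v` is in the cusp neighbourhood `cuspNhd d`. -/
def cuspTimes (v : T1M) (d : ℝ) : Set ℝ := {t | flow t v ∈ cuspNhd d}

theorem mem_cuspTimes_proj {v : T1H} {d t : ℝ} :
    t ∈ cuspTimes (proj v) d ↔ ∃ g : SL(2, ℤ), d < (g • (flowH t v).base).im := by
  change flow t (proj v) ∈ cuspNhd d ↔ _
  rw [flow_proj, cuspNhd]
  constructor
  · rintro ⟨w, hw, he⟩
    obtain ⟨g, hg⟩ : w ∈ MulAction.orbit SL(2, ℤ) (flowH t v) := Quotient.exact he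
    refine ⟨g, ?_⟩
    rw [← smul_base]
    simp only at hg
    rw [hg]
    exact hw
  · rintro ⟨g, hg⟩
    exact ⟨g • flowH t v, hg, Quotient.sound ⟨g, rfl⟩⟩

theorem isOpen_cuspTimes (v : T1M) (d : ℝ) : IsOpen (cuspTimes v d) := by
  obtain ⟨w, rfl⟩ : ∃ w, proj w = v := Quotient.exists_rep v
  have e : cuspTimes (proj w) d =
      ⋃ g : SL(2, ℤ), {t | d < (g • (flowH t w).base).im} := by
    ext t; rw [mem_cuspTimes_proj]; simp
  rw [e]
  refine isOpen_iUnion fun g => isOpen_lt continuous_const ?_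
  have hc : Continuous fun t : ℝ => ((flowH t w).base : ℂ) :=
    continuous_iff_continuousAt.mpr fun t => (hasDerivAt_flowH t w).continuousAt
  have hc' : Continuous fun t : ℝ => (flowH t w).base :=
    UpperHalfPlane.isEmbedding_coe.continuous_iff.mpr hc
  exact UpperHalfPlane.continuous_im.comp (hc'.const_smul (g : SL(2, ℝ)))

/-- Heights become inverse values at `(c, d)` of a positive definite form of determinant `1`, the
shape needed for comparing two cusps. -/
theorem im_smul_verticalRay (g : SL(2, ℤ)) (x t : ℝ) : (g • verticalRay x t).im =
    1 / ((g 1 0 : ℝ) ^ 2 * Real.exp (-t) + (g 1 0 * x + g 1 1) ^ 2 / Real.exp (-t)) := by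
  have he := Real.exp_pos (-t)
  have hf := factor_ne_zero g (verticalRay x t)
  rw [im_smul_eq, ← Complex.normSq_eq_norm_sq, verticalRay_im]
  have e : Complex.normSq (factor g (verticalRay x t)) =
      ((g 1 0 : ℝ) ^ 2 * Real.exp (-t) + (g 1 0 * x + g 1 1) ^ 2 / Real.exp (-t)) *
        Real.exp (-t) := by
    rw [add_mul, div_mul_cancel₀ _ he.ne', Complex.normSq_apply, coe_verticalRay, factor]
    simp
    ring
  have h0 : Complex.normSq (factor g (verticalRay x t)) ≠ 0 := by simpa using hf
  rw [e] at h0 ⊢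
  rw [div_eq_div_iff h0 (left_ne_zero_of_mul h0)]
  ring

/-- The time `t_n = 2 log |x_1 ⋯ x_n|` at which the excursion belonging to the `n`-th convergent
starts. -/
def returnTime (a b x : ℝ) (n : ℕ) : ℝ := -2 * Real.log |convErr a b x n|

theorem returnTime_zero (a b x : ℝ) : returnTime a b x 0 = 0 := by
  simp [returnTime, convErr_zero]

theorem exp_neg_returnTime {a b x : ℝ} (hx : Irrational x) (n : ℕ) :
    Real.exp (-returnTime a b x n) = convErr a b x n ^ 2 := by
  have h := convErr_ne_zero (a := a) (b := b) hx n
  rw [returnTime, neg_mul, neg_neg, mul_comm, Real.exp_mul, Real.exp_log (abs_pos.mpr h)]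
  norm_num

theorem returnTime_succ {a b x : ℝ} (hx : Irrational x) (n : ℕ) :
    returnTime a b x (n + 1) =
      returnTime a b x n + 2 * Real.log |completeQuotient a b x (n + 1)| := by
  obtain ⟨h0, he⟩ := convErr_succ (a := a) (b := b) hx n
  have hn := (irrational_completeQuotient (a := a) (b := b) hx (n + 1)).ne_zero
  rw [returnTime, returnTime, he, abs_mul,
    Real.log_mul (abs_ne_zero.mpr hn) (abs_ne_zero.mpr h0)]
  ring

/-- The quadratic form `q_n² e^{-t} + (q_n x - p_n)² e^t`, the inverse of the height of
`x + i e^{-t}` as seen from the cusp `p_n / q_n`. -/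
def convForm (a b x : ℝ) (n : ℕ) (t : ℝ) : ℝ :=
  (convDen a b x (n + 1) : ℝ) ^ 2 * Real.exp (-t) + convErr a b x (n + 1) ^ 2 / Real.exp (-t)

/-- The second summand is exactly `e^{t - t_{n+1}}`; the first is `(q_n e_n)² e^{t_n - t}`, whose
coefficient `convDen_mul_convErr_bounds` controls. -/
theorem convForm_bounds {a b x : ℝ} (hp : (a, b) ∈ paramP) (hx : Irrational x) (n : ℕ) (t : ℝ) :
    convForm a b x n t ≤ (1 + 1 / margin a b) ^ 2 * Real.exp (returnTime a b x n - t) +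
        Real.exp (t - returnTime a b x (n + 1)) ∧
      1 / 4 * Real.exp (returnTime a b x n - t) ≤ convForm a b x n t ∧
      Real.exp (t - returnTime a b x (n + 1)) ≤ convForm a b x n t := by
  obtain ⟨h1, h2⟩ := convDen_mul_convErr_bounds hp hx n
  have h0 := convErr_ne_zero (a := a) (b := b) hx n
  have e1 : convErr a b x (n + 1) ^ 2 / Real.exp (-t) =
      Real.exp (t - returnTime a b x (n + 1)) := by
    rw [← exp_neg_returnTime hx, ← Real.exp_sub]; ring_nf
  have e2 : (convDen a b x (n + 1) : ℝ) ^ 2 * Real.exp (-t) =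
      (convDen a b x (n + 1) * convErr a b x n) ^ 2 * Real.exp (returnTime a b x n - t) := by
    rw [sub_eq_add_neg, Real.exp_add, mul_pow, ← exp_neg_returnTime hx]
    have : Real.exp (-returnTime a b x n) * Real.exp (returnTime a b x n) = 1 := by
      rw [← Real.exp_add, neg_add_cancel, Real.exp_zero]
    linear_combination (-(convDen a b x (n + 1) : ℝ) ^ 2 * Real.exp (-t)) * this
  have hA := Real.exp_pos (returnTime a b x n - t)
  have hB := Real.exp_pos (t - returnTime a b x (n + 1))
  have hlow : 1 / 4 ≤ (convDen a b x (n + 1) * convErr a b x n) ^ 2 := by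
    rw [← sq_abs]; nlinarith
  have hup : (convDen a b x (n + 1) * convErr a b x n) ^ 2 ≤ (1 + 1 / margin a b) ^ 2 := by
    rw [← sq_abs]; gcongr
  rw [convForm, e1, e2]
  refine ⟨?_, ?_, ?_⟩
  · gcongr
  · have := mul_le_mul_of_nonneg_right hlow hA.le
    linarith
  · have := mul_nonneg (sq_nonneg (convDen a b x (n + 1) * convErr a b x n)) hA.le
    linarith

/-- A matrix of `SL(2,ℤ)` taking the `n`-th convergent to `∞`. -/
def convMatrix (a b x : ℝ) (n : ℕ) : SL(2, ℤ) :=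
  ⟨!![convDen a b x n, -convNum a b x n; convDen a b x (n + 1), -convNum a b x (n + 1)], by
    rw [Matrix.det_fin_two_of]; linarith [conv_det a b x n]⟩

theorem im_convMatrix_smul (a b x : ℝ) (n : ℕ) (t : ℝ) :
    (convMatrix a b x n • verticalRay x t).im = 1 / convForm a b x n t := by
  rw [im_smul_verticalRay, convForm, convErr]
  simp [convMatrix, sub_eq_add_neg]

/-- While the form of a convergent is bounded, only that convergent can be seen at large height. -/
theorem convForm_le_of_im_smul {a b x : ℝ} {n : ℕ} {t A : ℝ} (g : SL(2, ℤ))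
    (hA : convForm a b x n t ≤ A) (hg : A < (g • verticalRay x t).im) :
    convForm a b x n t * (g • verticalRay x t).im ≤ 1 := by
  have hpos := UpperHalfPlane.im_pos (g • verticalRay x t)
  have hs := Real.exp_pos (-t)
  rw [im_smul_verticalRay] at *
  set s := Real.exp (-t) with hsd
  set c : ℤ := g 1 0 with hc
  set d : ℤ := g 1 1 with hd
  have hdet : g 0 0 * d - g 0 1 * c = 1 := by
    have := g.det_coe; rw [Matrix.det_fin_two] at this; exact this
  set N := (c : ℝ) ^ 2 * s + (c * x + d) ^ 2 / s with hN
  have hN0 : 0 < N := one_div_pos.mp hpos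
  rw [mul_one_div, div_le_one hN0]
  set q := convDen a b x (n + 1) with hq
  set p := convNum a b x (n + 1) with hpn
  have hform : convForm a b x n t = (q : ℝ) ^ 2 * s + (q * x - p) ^ 2 / s := rfl
  -- Lagrange's identity: two values of a form of determinant `1` have product at least the squared
  -- determinant of their arguments.
  have hlag : ((c * p + d * q : ℤ) : ℝ) ^ 2 ≤ convForm a b x n t * N := by
    have e : convForm a b x n t * N = ((c * p + d * q : ℤ) : ℝ) ^ 2 +
        (q * c * s + (q * x - p) * (c * x + d) / s) ^ 2 := by
      rw [hform, hN]; push_cast; field_simp; ring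
    rw [e]; nlinarith [sq_nonneg (q * c * s + (q * x - p) * (c * x + d) / s)]
  -- If the determinant vanishes, `(c, d)` is a nonzero integer multiple of `(q, -p)`. If not, the
  -- product of the two forms is at least `1`, so the height `1 / N` is at most `A`.
  by_cases h : c * p + d * q = 0
  · set k : ℤ := c * convNum a b x n + d * convDen a b x n with hk
    have hcd := conv_det a b x n
    rw [← hq, ← hpn] at hcd
    have hcq : c = k * q := by linear_combination (-c) * hcd + (-convDen a b x n) * h
    have hdp : d = -(k * p) := by linear_combination (-d) * hcd + (convNum a b x n) * h
    have hk0 : k ≠ 0 := by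
      intro hk0; rw [hk0] at hcq hdp; simp at hcq hdp; rw [hcq, hdp] at hdet; simp at hdet
    have e : N = (k : ℝ) ^ 2 * convForm a b x n t := by
      rw [hN, hform, hcq, hdp]; push_cast; ring
    have hk1 : (1 : ℝ) ≤ (k : ℝ) ^ 2 := by
      have : 1 ≤ k ^ 2 := by have := pow_pos (abs_pos.mpr hk0) 2; rw [sq_abs] at this; omega
      exact_mod_cast this
    have h0 : 0 ≤ convForm a b x n t := by rw [hform]; positivity
    rw [e]; nlinarith
  · exfalso
    have h1 : (1 : ℝ) ≤ ((c * p + d * q : ℤ) : ℝ) ^ 2 := by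
      have : 1 ≤ (c * p + d * q) ^ 2 := by
        have := pow_pos (abs_pos.mpr h) 2; rw [sq_abs] at this; omega
      exact_mod_cast this
    rw [lt_div_iff₀ hN0] at hg
    have := mul_le_mul_of_nonneg_right hA hN0.le
    linarith

/-- Up to bounded errors, the part of `[t_n, t_{n+1}]` that the orbit spends in `cuspNhd d` is
`[t_n + log d, t_{n+1} - log d]`. -/
theorem exists_cuspTimes_bounds {a b : ℝ} (hp : (a, b) ∈ paramP) {v : T1H} {x : ℝ}
    (hirr : Irrational x) (hx : IsAttractingEndpoint v x) :
    ∃ C : ℝ, 0 ≤ C ∧ ∀ d : ℝ, 1 < d → ∀ (n : ℕ) (t : ℝ), 0 ≤ t →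
      (returnTime a b x n + Real.log d + C ≤ t → t ≤ returnTime a b x (n + 1) - Real.log d - C →
        t ∈ cuspTimes (proj v) d) ∧
      (C ≤ Real.log d → returnTime a b x n ≤ t → t ≤ returnTime a b x (n + 1) →
        t ∈ cuspTimes (proj v) d → returnTime a b x n + Real.log d - C ≤ t ∧
          t ≤ returnTime a b x (n + 1) - Real.log d + C) := by
  obtain ⟨K, hK0, hK⟩ := exists_dist_verticalRay_le hx
  set A : ℝ := (1 + 1 / margin a b) ^ 2 with hA
  have hA0 : 0 < A := by have := margin_pos hp; positivity
  have hlogA : 0 ≤ Real.log (A + 2) := Real.log_nonneg (by linarith)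
  have hlog4 : 0 ≤ Real.log 4 := Real.log_nonneg (by norm_num)
  -- `K` pays for the vertical geodesic, `A + 2` for the upper bound on the form, and `4` for its
  -- lower bound.
  refine ⟨K + Real.log (A + 2) + Real.log 4, by positivity, fun d hd n t ht => ?_⟩
  have hd0 : 0 < d := by linarith
  obtain ⟨hf1, hf2, hf3⟩ := convForm_bounds hp hirr n t
  have hpos : 0 < convForm a b x n t := (Real.exp_pos _).trans_le hf3
  constructor
  · intro h1 h2
    rw [mem_cuspTimes_proj]
    refine ⟨convMatrix a b x n, ?_⟩
    have h := im_smul_le_exp_dist_mul (convMatrix a b x n) (verticalRay x t) (flowH t v).base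
    rw [dist_comm, im_convMatrix_smul] at h
    have hexp : Real.exp (dist (flowH t v).base (verticalRay x t)) ≤ Real.exp K :=
      Real.exp_le_exp.mpr (hK t ht)
    have hE : Real.exp (-(Real.log d + K + Real.log (A + 2))) = 1 / (d * Real.exp K * (A + 2)) := by
      rw [Real.exp_neg, Real.exp_add, Real.exp_add, Real.exp_log hd0,
        Real.exp_log (by linarith), one_div]
    have e1 : Real.exp (returnTime a b x n - t) ≤ 1 / (d * Real.exp K * (A + 2)) := by
      rw [← hE]; exact Real.exp_le_exp.mpr (by linarith)
    have e2 : Real.exp (t - returnTime a b x (n + 1)) ≤ 1 / (d * Real.exp K * (A + 2)) := by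
      rw [← hE]; exact Real.exp_le_exp.mpr (by linarith)
    have hKp := Real.exp_pos K
    have hlt : convForm a b x n t < 1 / (d * Real.exp K) := by
      calc _ ≤ A * (1 / (d * Real.exp K * (A + 2))) + 1 / (d * Real.exp K * (A + 2)) :=
            hf1.trans (by gcongr)
        _ = (A + 1) / (A + 2) * (1 / (d * Real.exp K)) := by field_simp
        _ < 1 * (1 / (d * Real.exp K)) := by
            gcongr
            rw [div_lt_one (by linarith)]; linarith
        _ = _ := one_mul _
    have h3 : d * Real.exp K < 1 / convForm a b x n t := by
      rwa [lt_one_div (by positivity) hpos]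
    have him := UpperHalfPlane.im_pos (convMatrix a b x n • (flowH t v).base)
    have h4 := h.trans (mul_le_mul_of_nonneg_right hexp him.le)
    have h5 : d * Real.exp K < (convMatrix a b x n • (flowH t v).base).im * Real.exp K := by
      linarith
    exact lt_of_mul_lt_mul_right h5 hKp.le
  · intro hC h1 h2 hmem
    obtain ⟨g, hg⟩ := mem_cuspTimes_proj.mp hmem
    have h := im_smul_le_exp_dist_mul g (flowH t v).base (verticalRay x t)
    have hexp : Real.exp (dist (flowH t v).base (verticalRay x t)) ≤ Real.exp K :=
      Real.exp_le_exp.mpr (hK t ht)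
    have him := UpperHalfPlane.im_pos (g • verticalRay x t)
    have h3 : d < Real.exp K * (g • verticalRay x t).im :=
      hg.trans_le (h.trans (mul_le_mul_of_nonneg_right hexp him.le))
    have hform : convForm a b x n t ≤ A + 1 := by
      have e1 : Real.exp (returnTime a b x n - t) ≤ 1 := Real.exp_le_one_iff.mpr (by linarith)
      have e2 : Real.exp (t - returnTime a b x (n + 1)) ≤ 1 :=
        Real.exp_le_one_iff.mpr (by linarith)
      nlinarith
    -- A `d` this large places the height above the bound `A + 1` of the form, so `g` must see the
    -- `n`-th convergent.
    have hdA : Real.exp K * (A + 2) ≤ d := by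
      calc _ = Real.exp (K + Real.log (A + 2)) := by
            rw [Real.exp_add, Real.exp_log (show 0 < A + 2 by linarith)]
        _ ≤ Real.exp (Real.log d) := Real.exp_le_exp.mpr (by linarith)
        _ = d := Real.exp_log hd0
    have hlt : A + 1 < (g • verticalRay x t).im := by
      have : Real.exp K * (A + 2) < Real.exp K * (g • verticalRay x t).im := by linarith
      have := lt_of_mul_lt_mul_left this (Real.exp_pos K).le
      linarith
    have h4 := convForm_le_of_im_smul g hform hlt
    have h5 : convForm a b x n t * d ≤ Real.exp K := by
      have := mul_le_mul_of_nonneg_left h3.le hpos.le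
      have := mul_le_mul_of_nonneg_left h4 (Real.exp_pos K).le
      linarith
    have h6 : Real.log (convForm a b x n t) + Real.log d ≤ K := by
      rw [← Real.log_mul hpos.ne' hd0.ne', ← Real.log_exp K]
      exact Real.log_le_log (by positivity) h5
    have h7 : returnTime a b x n - t - Real.log 4 ≤ Real.log (convForm a b x n t) := by
      rw [Real.le_log_iff_exp_le hpos, Real.exp_sub, Real.exp_log (by norm_num)]
      linarith
    have h8 : t - returnTime a b x (n + 1) ≤ Real.log (convForm a b x n t) := by
      rwa [Real.le_log_iff_exp_le hpos]
    constructor <;> linarith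


/-! ### Averages along a sequence of excursions -/

/-- A family of sets of times `B d` for which the part of `[t_n, t_{n+1}]` in `B d` is
`[t_n + log d, t_{n+1} - log d]` up to bounded errors, where `t_{n+1} - t_n` is `2 l_n` up to a
bounded error, and `t` grows at least linearly. -/
structure ExcursionPattern (B : ℝ → Set ℝ) (t l : ℕ → ℝ) (C κ : ℝ) : Prop where
  measurable : ∀ d, MeasurableSet (B d)
  zero : t 0 = 0
  mono : Monotone t
  const_nonneg : 0 ≤ C
  rate_pos : 0 < κ
  l_nonneg : ∀ n, 0 ≤ l n
  step : ∀ n, |t (n + 1) - t n - 2 * l n| ≤ C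
  growth : ∀ n, κ ≤ t (n + 2) - t n
  lower : ∀ d, 1 < d → ∀ n s, 0 ≤ s → t n + Real.log d + C ≤ s →
    s ≤ t (n + 1) - Real.log d - C → s ∈ B d
  upper : ∀ d, 1 < d → C ≤ Real.log d → ∀ n s, 0 ≤ s → t n ≤ s → s ≤ t (n + 1) → s ∈ B d →
    t n + Real.log d - C ≤ s ∧ s ≤ t (n + 1) - Real.log d + C

/-- The time that a set `B` occupies in `(s, r]`. -/
def occupation (B : Set ℝ) (s r : ℝ) : ℝ := MeasureTheory.volume.real (B ∩ Set.Ioc s r)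

theorem occupation_ne_top (B : Set ℝ) (s r : ℝ) :
    MeasureTheory.volume (B ∩ Set.Ioc s r) ≠ ⊤ :=
  ((MeasureTheory.measure_mono Set.inter_subset_right).trans_lt measure_Ioc_lt_top).ne

theorem occupation_nonneg (B : Set ℝ) (s r : ℝ) : 0 ≤ occupation B s r :=
  MeasureTheory.measureReal_nonneg

theorem occupation_le {B : Set ℝ} {s r α β : ℝ}
    (h : ∀ u ∈ B, s < u → u ≤ r → α ≤ u ∧ u ≤ β) : occupation B s r ≤ max 0 (β - α) := by
  have hs : B ∩ Set.Ioc s r ⊆ Set.Icc α β := fun u hu => h u hu.1 hu.2.1 hu.2.2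
  have := MeasureTheory.measureReal_mono (μ := MeasureTheory.volume) hs measure_Icc_lt_top.ne
  refine this.trans_eq ?_
  rw [MeasureTheory.measureReal_def, Real.volume_Icc, ENNReal.toReal_ofReal']
  exact max_comm _ _

theorem le_occupation {B : Set ℝ} {s r α β : ℝ}
    (h : ∀ u, α < u → u ≤ β → u ∈ B ∧ s < u ∧ u ≤ r) : β - α ≤ occupation B s r := by
  have hs : Set.Ioc α β ⊆ B ∩ Set.Ioc s r := fun u hu => h u hu.1 hu.2
  have := MeasureTheory.measureReal_mono (μ := MeasureTheory.volume) hs (occupation_ne_top B s r)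
  refine le_trans ?_ this
  rw [MeasureTheory.measureReal_def, Real.volume_Ioc, ENNReal.toReal_ofReal']
  exact le_max_left _ _

theorem occupation_le_sub {B : Set ℝ} {s r : ℝ} (h : s ≤ r) : occupation B s r ≤ r - s := by
  have := occupation_le (B := B) (s := s) (r := r) (fun u _ h1 h2 => ⟨h1.le, h2⟩)
  rwa [max_eq_right (by linarith)] at this

theorem occupation_add {B : Set ℝ} (hB : MeasurableSet B) {s r w : ℝ} (h1 : s ≤ r)
    (h2 : r ≤ w) : occupation B s w = occupation B s r + occupation B r w := by
  rw [occupation, ← Set.Ioc_union_Ioc_eq_Ioc h1 h2, Set.inter_union_distrib_left]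
  refine MeasureTheory.measureReal_union ?_ (hB.inter measurableSet_Ioc)
    (occupation_ne_top B s r) (occupation_ne_top B r w)
  exact (Set.Ioc_disjoint_Ioc_of_le le_rfl).mono Set.inter_subset_right Set.inter_subset_right

/-- Growth is only available over two steps, since single increments may be tiny. The shift by `1`
accommodates odd indices, which start from `f 1 ≥ 0`. -/
theorem le_of_two_step_add {f : ℕ → ℝ} {c : ℝ} (hc : 0 ≤ c) (h0 : 0 ≤ f 0)
    (h1 : 0 ≤ f 1) (h2 : ∀ n, f n + c ≤ f (n + 2)) (n : ℕ) :
    c * (n - 1) / 2 ≤ f n := by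
  induction n using Nat.twoStepInduction with
  | zero => push_cast; linarith
  | one => push_cast; linarith
  | more n ih _ => have := h2 n; push_cast at *; linarith

/-! ### Frequencies of visits versus averages of excursion lengths -/

namespace ExcursionPattern

variable {B : ℝ → Set ℝ} {t l : ℕ → ℝ} {C κ : ℝ}

theorem nonneg (h : ExcursionPattern B t l C κ) (n : ℕ) : 0 ≤ t n := by
  rw [← h.zero]; exact h.mono (Nat.zero_le n)

theorem linear_le (h : ExcursionPattern B t l C κ) (n : ℕ) : κ * (n - 1) / 2 ≤ t n :=
  le_of_two_step_add h.rate_pos.le (h.nonneg 0) (h.nonneg 1) (fun n => by linarith [h.growth n]) n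

theorem tendsto_times (h : ExcursionPattern B t l C κ) : Tendsto t atTop atTop := by
  refine tendsto_atTop_mono h.linear_le ?_
  have h1 : Tendsto (fun n : ℕ => (n : ℝ) - 1) atTop atTop :=
    tendsto_atTop_add_const_right _ (-1) tendsto_natCast_atTop_atTop
  exact (h1.const_mul_atTop h.rate_pos).atTop_div_const two_pos

theorem exists_mem_Icc (h : ExcursionPattern B t l C κ) (N₀ : ℕ) {T : ℝ} (hT : t N₀ ≤ T) :
    ∃ N, N₀ ≤ N ∧ t N ≤ T ∧ T ≤ t (N + 1) := by
  have hex : ∃ m, T < t m := (h.tendsto_times.eventually_gt_atTop T).exists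
  classical
  have h1 := Nat.find_spec hex
  have h2 : N₀ < Nat.find hex := by
    by_contra hc
    exact absurd (h.mono (not_lt.mp hc)) (not_le.mpr (hT.trans_lt h1))
  obtain ⟨m, hm⟩ : ∃ m, Nat.find hex = m + 1 := ⟨Nat.find hex - 1, by omega⟩
  refine ⟨m, by omega, ?_, by rw [← hm]; exact h1.le⟩
  exact not_lt.mp (Nat.find_min hex (by omega))

theorem occupation_eq_sum (h : ExcursionPattern B t l C κ) (d : ℝ) (N : ℕ) :
    occupation (B d) 0 (t N) = ∑ n ∈ Finset.range N, occupation (B d) (t n) (t (n + 1)) := by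
  induction N with
  | zero => rw [h.zero]; simp [occupation]
  | succ N ih =>
    rw [Finset.sum_range_succ, ← ih]
    exact occupation_add (h.measurable d) (h.nonneg N) (h.mono (Nat.le_succ N))

/-- If the interval supplied by `lower` is empty, the left side is nonpositive and the bound is
trivial. -/
theorem le_occupation_step (h : ExcursionPattern B t l C κ) {d : ℝ} (hd : 1 < d) (n : ℕ) :
    t (n + 1) - t n - 2 * Real.log d - 2 * C ≤ occupation (B d) (t n) (t (n + 1)) := by
  have hl := Real.log_pos hd
  have := h.const_nonneg
  have hn := h.nonneg n
  refine le_trans (le_of_eq ?_) (le_occupation (α := t n + Real.log d + C)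
    (β := t (n + 1) - Real.log d - C) fun u h1 h2 =>
      ⟨h.lower d hd n u (by linarith) h1.le h2, by linarith, by linarith⟩)
  ring

theorem occupation_step_le (h : ExcursionPattern B t l C κ) {d : ℝ} (hd : 1 < d)
    (hC : C ≤ Real.log d) (n : ℕ) : occupation (B d) (t n) (t (n + 1)) ≤
      max 0 (t (n + 1) - t n - 2 * Real.log d + 2 * C) := by
  have hn := h.nonneg n
  refine (occupation_le (α := t n + Real.log d - C) (β := t (n + 1) - Real.log d + C)
    fun u hu h1 h2 => h.upper d hd hC n u (by linarith) h1.le h2 hu).trans_eq ?_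
  congr 1; ring

/-- The sum of the `l_n` that exceed the threshold `r`. -/
def largeSum (l : ℕ → ℝ) (r : ℝ) (N : ℕ) : ℝ :=
  ∑ n ∈ Finset.range N, if r < l n then l n else 0

theorem largeSum_nonneg (h : ExcursionPattern B t l C κ) (r : ℝ) (N : ℕ) : 0 ≤ largeSum l r N :=
  Finset.sum_nonneg fun n _ => by split_ifs; exacts [h.l_nonneg n, le_rfl]

/-- A step with `l_n ≤ r` has length at most `2 r + C`, so only long excursions can make `t` grow
faster than linearly. -/
theorem le_largeSum (h : ExcursionPattern B t l C κ) {r : ℝ} (hr : 0 ≤ r) (N : ℕ) :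
    t N ≤ 2 * largeSum l r N + (2 * r + C) * N := by
  induction N with
  | zero => rw [h.zero]; simp [largeSum]
  | succ N ih =>
    have h1 := (abs_le.mp (h.step N)).2
    rw [largeSum, Finset.sum_range_succ, ← largeSum]
    push_cast
    split_ifs with hc
    · linarith
    · linarith

theorem abs_sub_two_mul_sum_le (h : ExcursionPattern B t l C κ) (N : ℕ) :
    |t N - 2 * ∑ n ∈ Finset.range N, l n| ≤ C * N := by
  induction N with
  | zero => simp [h.zero]
  | succ N ih =>
    rw [Finset.sum_range_succ]
    have e : t (N + 1) - 2 * (∑ n ∈ Finset.range N, l n + l N) =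
      (t N - 2 * ∑ n ∈ Finset.range N, l n) + (t (N + 1) - t N - 2 * l N) := by ring
    rw [e]
    refine (abs_add_le _ _).trans ?_
    have := h.step N
    push_cast
    linarith

theorem tendsto_largeSum (h : ExcursionPattern B t l C κ) {d : ℝ} (hd : 1 < d)
    (hB : Tendsto (fun T => 1 / T * occupation (B d) 0 T) atTop (𝓝 0)) :
    ∃ r, 0 < r ∧ Tendsto (fun N : ℕ => 1 / (N : ℝ) * largeSum l r N) atTop (𝓝 0) := by
  have hl := Real.log_pos hd
  have hC := h.const_nonneg
  -- An excursion with `l_n > r` spends at least `2 l_n - r > l_n` in `B d`.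
  set r : ℝ := 3 * C + 2 * Real.log d with hr
  have hr0 : 0 < r := by positivity
  refine ⟨r, hr0, ?_⟩
  have hle : ∀ N, largeSum l r N ≤ occupation (B d) 0 (t N) := by
    intro N
    rw [h.occupation_eq_sum, largeSum]
    refine Finset.sum_le_sum fun n _ => ?_
    split_ifs with hc
    · have h1 := (abs_le.mp (h.step n)).1
      have h2 := h.le_occupation_step hd n
      linarith
    · exact occupation_nonneg _ _ _
  have hp : Tendsto (fun N => 1 / t N * occupation (B d) 0 (t N)) atTop (𝓝 0) :=
    hB.comp h.tendsto_times
  have hp' : Tendsto (fun N => 2 * (2 * r + C) * (1 / t N * occupation (B d) 0 (t N))) atTop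
      (𝓝 0) := by simpa using hp.const_mul (2 * (2 * r + C))
  refine tendsto_of_tendsto_of_tendsto_of_le_of_le' tendsto_const_nhds hp' ?_ ?_
  · exact Eventually.of_forall fun N => mul_nonneg (by positivity) (h.largeSum_nonneg r N)
  · filter_upwards [hp.eventually (gt_mem_nhds (show (0 : ℝ) < 1 / 4 by norm_num)),
      h.tendsto_times.eventually_gt_atTop 0, eventually_gt_atTop 0] with N h1 h2 h3
    have hN : (0 : ℝ) < N := by exact_mod_cast h3
    have hocc : occupation (B d) 0 (t N) = (1 / t N * occupation (B d) 0 (t N)) * t N := by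
      field_simp
    have hnn : 0 ≤ 1 / t N * occupation (B d) 0 (t N) :=
      mul_nonneg (by positivity) (occupation_nonneg _ _ _)
    have hm := hle N
    rw [hocc] at hm
    have ht := h.le_largeSum hr0.le N
    have hs := h.largeSum_nonneg r N
    generalize 1 / t N * occupation (B d) 0 (t N) = p at *
    -- As `t N` may be superlinear, its large part is absorbed on the left: `p ≤ 1 / 4` leaves half
    -- of `largeSum l r N`.
    have h4 : p * t N ≤ p * (2 * largeSum l r N + (2 * r + C) * N) := by gcongr
    have h5 : p * largeSum l r N ≤ 1 / 4 * largeSum l r N := by gcongr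
    rw [one_div, inv_mul_le_iff₀ hN]
    linarith

theorem exists_tendsto_occupation_zero (h : ExcursionPattern B t l C κ) {r : ℝ} (hr : 0 < r)
    (hl : Tendsto (fun N : ℕ => 1 / (N : ℝ) * largeSum l r N) atTop (𝓝 0)) :
    ∃ d, 1 < d ∧ Tendsto (fun T => 1 / T * occupation (B d) 0 T) atTop (𝓝 0) := by
  have hC := h.const_nonneg
  have hκ := h.rate_pos
  -- At height `e^D` the occupation in one step is at most `max 0 (2 l_n - 2 r - C)`, which vanishes
  -- when `l_n ≤ r`.
  set D : ℝ := r + 2 * C with hD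
  have hD0 : 0 < D := by positivity
  have hd : 1 < Real.exp D := Real.one_lt_exp_iff.mpr hD0
  have hlog : Real.log (Real.exp D) = D := Real.log_exp D
  refine ⟨Real.exp D, hd, ?_⟩
  have hle : ∀ N, occupation (B (Real.exp D)) 0 (t N) ≤ 2 * largeSum l r N := by
    intro N
    rw [h.occupation_eq_sum, largeSum, Finset.mul_sum]
    refine Finset.sum_le_sum fun n _ => ?_
    have h1 := (abs_le.mp (h.step n)).2
    have h2 := h.occupation_step_le hd (by rw [hlog]; linarith) n
    rw [hlog] at h2
    refine h2.trans (max_le ?_ ?_)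
    · split_ifs <;> linarith [h.l_nonneg n]
    · split_ifs with hc <;> linarith
  rw [Metric.tendsto_atTop]
  intro ε hε
  have hev := hl.eventually (gt_mem_nhds (show 0 < ε * κ / 24 by positivity))
  obtain ⟨N₀, hN₀⟩ := eventually_atTop.mp hev
  refine ⟨t (N₀ + 2), fun T hT => ?_⟩
  obtain ⟨N, hN, hN1, hN2⟩ := h.exists_mem_Icc (N₀ + 2) hT
  have hN2' : (2 : ℝ) ≤ N := by exact_mod_cast (by omega : 2 ≤ N)
  have hlin := h.linear_le N
  have hlarge := hN₀ (N + 1) (by omega)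
  -- `(N - 1) / 2 ≥ (N + 1) / 6` for `N ≥ 2`; with the threshold `ε κ / 24` the occupation is then
  -- below `ε T`.
  have hT0 : κ * (N + 1) / 6 ≤ T := by nlinarith
  have hTpos : 0 < T := lt_of_lt_of_le (by positivity) hT0
  rw [one_div, inv_mul_lt_iff₀ (by positivity)] at hlarge
  push_cast at hlarge
  have hocc : occupation (B (Real.exp D)) 0 T ≤ 2 * largeSum l r (N + 1) := by
    refine le_trans ?_ (hle (N + 1))
    have := occupation_add (h.measurable (Real.exp D)) hTpos.le hN2
    have := occupation_nonneg (B (Real.exp D)) T (t (N + 1))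
    linarith
  rw [dist_zero_right, Real.norm_of_nonneg (mul_nonneg (by positivity) (occupation_nonneg _ _ _)),
    one_div, inv_mul_lt_iff₀ hTpos]
  have : ε * (κ * (N + 1) / 6) ≤ ε * T := by gcongr
  have : 0 < ε * κ * (N + 1) := by positivity
  linarith

/-- Each step spends at most a constant time outside `B d`, while the average step length tends to
infinity. -/
theorem tendsto_occupation_one (h : ExcursionPattern B t l C κ)
    (hl : Tendsto (fun N : ℕ => 1 / (N : ℝ) * ∑ n ∈ Finset.range N, l n) atTop atTop)
    {d : ℝ} (hd : 1 < d) :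
    Tendsto (fun T => 1 / T * occupation (B d) 0 T) atTop (𝓝 1) := by
  have hC := h.const_nonneg
  have hlog := Real.log_pos hd
  set K : ℝ := 2 * Real.log d + 2 * C with hK
  have hK0 : 0 < K := by positivity
  have hout : ∀ N : ℕ, t N - occupation (B d) 0 (t N) ≤ K * N := by
    intro N
    induction N with
    | zero => rw [h.zero]; simp [occupation]
    | succ N ih =>
      have h1 := occupation_add (h.measurable d) (h.nonneg N) (h.mono (Nat.le_succ N))
      have h2 := h.le_occupation_step hd N
      push_cast
      simp only [Nat.succ_eq_add_one] at h1
      linarith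
  rw [Metric.tendsto_atTop]
  intro ε hε
  set R : ℝ := 4 * K / ε with hR
  have hR0 : 0 < R := by positivity
  obtain ⟨N₀, hN₀⟩ := eventually_atTop.mp (hl.eventually_ge_atTop ((R + C) / 2))
  refine ⟨t (N₀ + 1), fun T hT => ?_⟩
  obtain ⟨N, hN, hN1, hN2⟩ := h.exists_mem_Icc (N₀ + 1) hT
  have hNpos : (1 : ℝ) ≤ N := by exact_mod_cast (by omega : 1 ≤ N)
  have hsum := hN₀ N (by omega)
  rw [one_div, le_inv_mul_iff₀ (by linarith)] at hsum
  have habs := (abs_le.mp (h.abs_sub_two_mul_sum_le N)).1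
  have htN : R * N ≤ T := by linarith
  have hTpos : 0 < T := lt_of_lt_of_le (by positivity) htN
  have h1 := occupation_add (h.measurable d) hTpos.le hN2
  have h2 := occupation_le_sub (B := B d) hN2
  have h3 := hout (N + 1)
  push_cast at h3
  have h4 := occupation_le_sub (B := B d) hTpos.le
  have hT1 : 1 / T * occupation (B d) 0 T - 1 = -((T - occupation (B d) 0 T) / T) := by
    field_simp; ring
  rw [Real.dist_eq, hT1, abs_neg, abs_of_nonneg (div_nonneg (by linarith) hTpos.le),
    div_lt_iff₀ hTpos]
  have h5 : ε * (R * N) ≤ ε * T := by gcongr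
  have h6 : ε * (R * N) = 4 * K * N := by rw [hR]; field_simp
  nlinarith

/-- A single `d = e^{C+1}` suffices: each step spends at least `min (t_{n+1} - t_n) 2` outside,
hence the time outside grows at least linearly in `N`. Being `o(t_N)`, it forces `t_N / N → ∞`. -/
theorem tendsto_sum_atTop (h : ExcursionPattern B t l C κ)
    (hB : ∀ d, 1 < d → Tendsto (fun T => 1 / T * occupation (B d) 0 T) atTop (𝓝 1)) :
    Tendsto (fun N : ℕ => 1 / (N : ℝ) * ∑ n ∈ Finset.range N, l n) atTop atTop := by
  have hC := h.const_nonneg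
  have hκ := h.rate_pos
  have hd : 1 < Real.exp (C + 1) := Real.one_lt_exp_iff.mpr (by linarith)
  have hlog : Real.log (Real.exp (C + 1)) = C + 1 := Real.log_exp _
  set B₁ := B (Real.exp (C + 1)) with hB₁
  set c : ℝ := min κ 2 with hc
  have hc0 : 0 < c := lt_min hκ two_pos
  have hstep : ∀ n, min (t (n + 1) - t n) 2 ≤
      t (n + 1) - t n - occupation B₁ (t n) (t (n + 1)) := by
    intro n
    have h1 := h.occupation_step_le hd (by rw [hlog]; linarith) n
    rw [hlog] at h1
    rcases max_choice 0 (t (n + 1) - t n - 2 * (C + 1) + 2 * C) with he | he <;> rw [he] at h1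
    · have := min_le_left (t (n + 1) - t n) 2; linarith
    · have := min_le_right (t (n + 1) - t n) 2; linarith
  have hadd : ∀ n, occupation B₁ 0 (t (n + 1)) =
      occupation B₁ 0 (t n) + occupation B₁ (t n) (t (n + 1)) := fun n =>
    occupation_add (h.measurable _) (h.nonneg n) (h.mono (Nat.le_succ n))
  have hout : ∀ n : ℕ, c * (n - 1) / 2 ≤ t n - occupation B₁ 0 (t n) := by
    refine le_of_two_step_add hc0.le ?_ ?_ fun n => ?_
    · have := occupation_le_sub (B := B₁) (h.nonneg 0); linarith
    · have := occupation_le_sub (B := B₁) (h.nonneg 1); linarith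
    · have h1 := hstep n
      have h2 := hstep (n + 1)
      have h3 := hadd n
      have h4 := hadd (n + 1)
      have hm1 := h.mono (Nat.le_succ n)
      have hm2 := h.mono (Nat.le_succ (n + 1))
      have hg := h.growth n
      simp only [Nat.succ_eq_add_one, add_assoc, Nat.reduceAdd] at *
      have : c ≤ min (t (n + 1) - t n) 2 + min (t (n + 2) - t (n + 1)) 2 := by
        have c1 := min_le_left κ 2
        have c2 := min_le_right κ 2
        rcases min_choice (t (n + 1) - t n) 2 with e | e <;>
        rcases min_choice (t (n + 2) - t (n + 1)) 2 with e' | e' <;> rw [e, e'] <;> linarith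
      linarith
  have hp : Tendsto (fun N => 1 / t N * occupation B₁ 0 (t N)) atTop (𝓝 1) :=
    (hB _ hd).comp h.tendsto_times
  rw [tendsto_atTop]
  intro K
  set K' : ℝ := max K 1 with hK'
  have hK1 : 1 ≤ K' := le_max_right _ _
  have hKK : K ≤ K' := le_max_left _ _
  -- The time outside is at least `c N / 4` and less than `δ t_N`, giving `t_N ≥ (2 K' + C) N`.
  set δ : ℝ := c / (4 * (2 * K' + C)) with hδ
  have hδ0 : 0 < δ := by positivity
  filter_upwards [hp.eventually (lt_mem_nhds (show 1 - δ < 1 by linarith)),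
    h.tendsto_times.eventually_gt_atTop 0, eventually_ge_atTop 2] with N h1 h2 h3
  have hN : (2 : ℝ) ≤ N := by exact_mod_cast h3
  have ho := hout N
  rw [one_div, lt_inv_mul_iff₀ h2] at h1
  have h4 : c * N / 4 ≤ δ * t N := by nlinarith
  have h5 : (2 * K' + C) * N ≤ t N := by
    have e : c * N / 4 = δ * ((2 * K' + C) * N) := by rw [hδ]; field_simp
    rw [e] at h4
    exact le_of_mul_le_mul_left h4 hδ0
  have habs := (abs_le.mp (h.abs_sub_two_mul_sum_le N)).2
  rw [one_div, le_inv_mul_iff₀ (by linarith)]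
  have : (N : ℝ) * K ≤ N * K' := by gcongr
  linarith

end ExcursionPattern

/-! ### Shifting averages -/

/-- The `N`-th Cesàro mean. -/
def cesaroMean (f : ℕ → ℝ) (N : ℕ) : ℝ := 1 / (N : ℝ) * ∑ j ∈ Finset.range N, f j

theorem cesaroMean_succ (f : ℕ → ℝ) (N : ℕ) : cesaroMean f (N + 1) =
    (N : ℝ) / (N + 1) * cesaroMean (fun n => f (n + 1)) N + f 0 * (1 / ((N : ℝ) + 1)) := by
  rw [cesaroMean, cesaroMean, Finset.sum_range_succ']
  rcases Nat.eq_zero_or_pos N with rfl | hN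
  · simp
  · have : (0 : ℝ) < N := by exact_mod_cast hN
    push_cast
    field_simp

theorem cesaroMean_shift (f : ℕ → ℝ) {N : ℕ} (hN : 0 < N) :
    cesaroMean (fun n => f (n + 1)) N =
      (1 + 1 / (N : ℝ)) * cesaroMean f (N + 1) - f 0 * (1 / (N : ℝ)) := by
  rw [cesaroMean_succ]
  have : (0 : ℝ) < N := by exact_mod_cast hN
  field_simp
  ring

/-- Excursions correspond to the digits from `a_1` on. The digit `a_0` may be `0`, where `Real.log 0
= 0` supplies the convention, and it does not affect the limit. -/
theorem tendsto_cesaroMean_shift_zero (f : ℕ → ℝ) :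
    Tendsto (cesaroMean f) atTop (𝓝 0) ↔
      Tendsto (cesaroMean fun n => f (n + 1)) atTop (𝓝 0) := by
  rw [← tendsto_add_atTop_iff_nat 1]
  constructor
  · intro h
    have h1 := tendsto_one_div_atTop_nhds_zero_nat (𝕜 := ℝ)
    have h2 := ((h1.const_add 1).mul h).sub (h1.const_mul (f 0))
    simp only [mul_zero, sub_zero] at h2
    refine h2.congr' ?_
    filter_upwards [eventually_gt_atTop 0] with N hN
    rw [cesaroMean_shift f hN]
  · intro h
    have h1 := tendsto_natCast_div_add_atTop (1 : ℝ)
    have h2 := (h1.mul h).add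
      ((tendsto_one_div_add_atTop_nhds_zero_nat (𝕜 := ℝ)).const_mul (f 0))
    simp only [mul_zero, add_zero] at h2
    exact h2.congr fun N => (cesaroMean_succ f N).symm

theorem tendsto_cesaroMean_shift_atTop (f : ℕ → ℝ) :
    Tendsto (cesaroMean f) atTop atTop ↔
      Tendsto (cesaroMean fun n => f (n + 1)) atTop atTop := by
  rw [← tendsto_add_atTop_iff_nat 1]
  constructor
  · intro h
    have h1 := tendsto_one_div_atTop_nhds_zero_nat (𝕜 := ℝ)
    have h2 := ((h1.const_add 1).pos_mul_atTop (by norm_num) h).atTop_add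
      (h1.const_mul (f 0)).neg
    refine h2.congr' ?_
    filter_upwards [eventually_gt_atTop 0] with N hN
    rw [cesaroMean_shift f hN, sub_eq_add_neg]
  · intro h
    have h1 := tendsto_natCast_div_add_atTop (1 : ℝ)
    have h2 := (h1.pos_mul_atTop one_pos h).atTop_add
      ((tendsto_one_div_add_atTop_nhds_zero_nat (𝕜 := ℝ)).const_mul (f 0))
    exact h2.congr fun N => (cesaroMean_succ f N).symm

/-! ### The excursion pattern of a geodesic -/

theorem cuspProportion_eq (d : ℝ) (v : T1M) {T : ℝ} (hT : 0 ≤ T) :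
    cuspProportion d v T = 1 / T * occupation (cuspTimes v d) 0 T := by
  have hm := (isOpen_cuspTimes v d).measurableSet
  rw [cuspProportion, intervalIntegral.integral_of_le hT, occupation,
    ← MeasureTheory.measureReal_restrict_apply hm, ← MeasureTheory.integral_indicator_one hm]
  rfl

theorem tendsto_cuspProportion_iff (d : ℝ) (v : T1M) (L : Filter ℝ) :
    Tendsto (cuspProportion d v) atTop L ↔
      Tendsto (fun T => 1 / T * occupation (cuspTimes v d) 0 T) atTop L :=
  tendsto_congr' ((eventually_ge_atTop 0).mono fun _ hT => cuspProportion_eq d v hT)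

theorem exists_excursionPattern {a b : ℝ} (hp : (a, b) ∈ paramP) {v : T1H} {x : ℝ}
    (hirr : Irrational x) (hx : IsAttractingEndpoint v x) :
    ∃ C κ : ℝ, ExcursionPattern (cuspTimes (proj v)) (returnTime a b x)
      (fun n => Real.log |(partialQuotient a b x (n + 1) : ℝ)|) C κ := by
  obtain ⟨C₀, hC₀, hcusp⟩ := exists_cuspTimes_bounds hp hirr hx
  have hlog2 : 0 < Real.log 2 := Real.log_pos one_lt_two
  have hq : ∀ n, 0 < Real.log |completeQuotient a b x (n + 1)| := fun n =>
    Real.log_pos (one_lt_abs_completeQuotient hp hirr n)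
  have hm := margin_pos hp
  -- `2 log 2` is the cost of replacing `|x_{n+1}|` by `|a_{n+1}|`; the rate is the two-step
  -- expansion of `one_add_margin_le_mul_next`.
  refine ⟨C₀ + 2 * Real.log 2, 2 * Real.log (1 + margin a b),
    { measurable := fun d => (isOpen_cuspTimes _ d).measurableSet
      zero := returnTime_zero a b x
      mono := monotone_nat_of_le_succ fun n => ?_
      const_nonneg := by positivity
      rate_pos := mul_pos two_pos (Real.log_pos (by linarith))
      l_nonneg := fun n => ?_
      step := fun n => ?_
      growth := fun n => ?_
      lower := fun d hd n s hs h1 h2 =>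
        (hcusp d hd n s hs).1 (by linarith) (by linarith)
      upper := fun d hd hC n s hs h1 h2 hmem => ?_ }⟩
  · have := hq n
    rw [returnTime_succ hirr]; linarith
  · exact Real.log_nonneg (abs_intPart_bounds hp (one_lt_abs_completeQuotient hp hirr n)).1
  · obtain ⟨h1, h2, h3⟩ := abs_intPart_bounds hp (one_lt_abs_completeQuotient hp hirr n)
    have hy := one_lt_abs_completeQuotient hp hirr n
    rw [returnTime_succ hirr]
    change abs (_ + 2 * Real.log |completeQuotient a b x (n + 1)| - _ - 2 * Real.log
      |(intPart a b (completeQuotient a b x (n + 1)) : ℝ)|) ≤ _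
    generalize abs (completeQuotient a b x (n + 1)) = y at *
    generalize abs (intPart a b (completeQuotient a b x (n + 1)) : ℝ) = k at *
    have e1 := Real.log_le_log (by linarith) h2
    have e2 := Real.log_le_log (by linarith) h3
    rw [Real.log_mul two_ne_zero (by linarith)] at e1 e2
    exact abs_le.mpr ⟨by linarith, by linarith⟩
  · have h1 := one_add_margin_le_mul_next hp (irrational_completeQuotient hirr (n + 1))
      (one_lt_abs_completeQuotient hp hirr n)
    have h2 : Real.log (1 + margin a b) ≤ Real.log |completeQuotient a b x (n + 1)| +
        Real.log |completeQuotient a b x (n + 2)| := by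
      rw [← Real.log_mul (by have := one_lt_abs_completeQuotient hp hirr n; linarith)
        (by have := one_lt_abs_completeQuotient hp hirr (n + 1); linarith)]
      exact Real.log_le_log (by linarith) h1
    rw [returnTime_succ hirr, returnTime_succ hirr]
    linarith
  · have := (hcusp d hd n s hs).2 (by linarith) h1 h2 hmem
    exact ⟨by linarith [this.1], by linarith [this.2]⟩

/-- Replacing a digit by `1` deletes its logarithm, so `ξ` acts as the threshold `log ξ` of
`largeSum`. -/
theorem log_abs_modifiedQuotient {a b x ξ : ℝ} (hp : (a, b) ∈ paramP) (hx : Irrational x)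
    (hξ : 0 < ξ) (n : ℕ) : Real.log |(modifiedQuotient a b x ξ (n + 1) : ℝ)| =
      if Real.log ξ < Real.log |(partialQuotient a b x (n + 1) : ℝ)| then
        Real.log |(partialQuotient a b x (n + 1) : ℝ)| else 0 := by
  have h1 : 1 ≤ |(partialQuotient a b x (n + 1) : ℝ)| :=
    (abs_intPart_bounds hp (one_lt_abs_completeQuotient hp hx n)).1
  simp only [modifiedQuotient, Real.log_lt_log_iff hξ (one_pos.trans_le h1)]
  split_ifs <;> simp

theorem tendsto_modifiedLogAverage_iff {a b x ξ : ℝ} (hp : (a, b) ∈ paramP) (hx : Irrational x)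
    (hξ : 0 < ξ) : Tendsto (modifiedLogAverage a b x ξ) atTop (𝓝 0) ↔
      Tendsto (fun N : ℕ => 1 / (N : ℝ) * ExcursionPattern.largeSum
        (fun n => Real.log |(partialQuotient a b x (n + 1) : ℝ)|) (Real.log ξ) N) atTop (𝓝 0) := by
  refine (tendsto_cesaroMean_shift_zero
    fun n => Real.log |(modifiedQuotient a b x ξ n : ℝ)|).trans (tendsto_congr fun N => ?_)
  rw [cesaroMean, ExcursionPattern.largeSum]
  simp only [log_abs_modifiedQuotient hp hx hξ]

end CuspExcursion

end

open CuspExcursion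

theorem theorem1p3 (a b : ℝ) (hab : (a, b) ∈ paramS)
    (v : T1M) (vtilde : T1H) (hlift : proj vtilde = v)
    (x : ℝ) (hirr : Irrational x) (hx : IsAttractingEndpoint vtilde x) :
    (VisitsCuspWithFreqZero v ↔
      ∃ ξ : ℝ, 1 < ξ ∧
        Filter.Tendsto (fun N : ℕ => modifiedLogAverage a b x ξ N) Filter.atTop (nhds 0)) ∧
    (VisitsCuspWithFreqOne v ↔
      Filter.Tendsto (fun N : ℕ => logAverage a b x N) Filter.atTop Filter.atTop) := by
  have hp : (a, b) ∈ paramP := hab.1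
  subst hlift
  obtain ⟨C, κ, h⟩ := exists_excursionPattern hp hirr hx
  refine ⟨⟨?_, ?_⟩, ⟨fun hv => ?_, fun hl d hd => ?_⟩⟩
  · rintro ⟨d, hd, hv⟩
    obtain ⟨r, hr, hl⟩ := h.tendsto_largeSum hd ((tendsto_cuspProportion_iff _ _ _).mp hv)
    refine ⟨Real.exp r, Real.one_lt_exp_iff.mpr hr,
      (tendsto_modifiedLogAverage_iff hp hirr (Real.exp_pos r)).mpr ?_⟩
    rwa [Real.log_exp]
  · rintro ⟨ξ, hξ, hl⟩
    obtain ⟨d, hd, hv⟩ := h.exists_tendsto_occupation_zero (Real.log_pos hξ)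
      ((tendsto_modifiedLogAverage_iff hp hirr (by linarith)).mp hl)
    exact ⟨d, hd, (tendsto_cuspProportion_iff _ _ _).mpr hv⟩
  · exact (tendsto_cesaroMean_shift_atTop
      fun n => Real.log |(partialQuotient a b x n : ℝ)|).mpr (h.tendsto_sum_atTop
        fun d hd => (tendsto_cuspProportion_iff _ _ _).mp (hv d hd))
  · exact (tendsto_cuspProportion_iff _ _ _).mpr (h.tendsto_occupation_one
      ((tendsto_cesaroMean_shift_atTop
        fun n => Real.log |(partialQuotient a b x n : ℝ)|).mp hl) hd)
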